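/- **Model.** Fix a capacity $n$ and a universe $\mathcal U$ of size $u$. An approximate membership query data structure (AMQ) has a private random string $\rho$, uniform in $\{0,1\}^{\mathbb N}$, and a state consisting of two bit strings $(L,R)$ (local and remote). It is given by deterministic functions of their arguments and of $\rho$ (measurable in $\rho$): $\mathrm{Build}(\rho)=(L,R)$; $\mathrm{Lookup}(L,x,\rho)=(L',b)$ with $b\in\{\text{Present},\text{Absent}\}$; and $\mathrm{Insert}$, $\mathrm{Delete}$, $\mathrm{Update}$, each of which maps $((L,R),x,\rho)$ to a new state $(L',R')$. It is accessed through an oracle that maintains the current set $\mathcal S$ (initially empty). The oracle ignores an insertion of $x$ if $|\mathcal S|\ge n$ or $x\in\mathcal S$, and a deletion of $x$ if $x\notin\mathcal S$. On a lookup of $x$ it runs $\mathrm{Lookup}$ and, if the answer is Present although $x\notin\mathcal S$ (a false positive), it then runs $\mathrm{Update}$ on $x$; thus the AMQ is told which of its positive answers are false. There are no false negatives: for every $\rho$, in every state reachable by oracle operations, a lookup of an $x\in\mathcal S$ is answered Present. An adversary adaptively issues finitely many insertions, deletions and lookups, seeing only the answers to its lookups, and finally outputs an element $x'$; it *wins*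 if $x'\notin\mathcal S$ and a lookup of $x'$ in the final state is answered Present. The AMQ has *sustained false-positive rate* $\varepsilon$ if every adversary wins with probability at most $\varepsilon$ over $\rho$. It has this rate *regardless of the history* if, for every deterministic adversary, the probability of winning is at most $\varepsilon$ also conditionally on every possible sequence of answers seen by the adversary. The *space* used in an interaction is the maximum, over all times between operations of the interaction, of the total number $|L|+|R|$ of bits of the state. **Theorem.** For every constant $\varepsilon<1$ there is a constant $c>0$ such that, with $$B(n,u)=c\cdot\min\{\,n\log_2 n,\; n\log_2\log_2 u\,\},$$ the following hold. 1. For every $\delta>0$ there is an $N$ such that for all $n\ge N$ and $u>n^4$: for every AMQ of capacity $n$ over a universe of size $u$ with sustained false-positive rate $\varepsilon$, there is a (deterministic) adversary against which the AMQ uses at least $B(n,u)$ bits of space with probability at least $1-\varepsilon-\delta$. (In particular, no AMQ with sustained false-positive rate $\varepsilon$ uses fewer than $B(n,u)$ bits with high probability.) 2. There is an $N$ such that for all $n\ge N$ and $u>n^4$: for every AMQ of capacity $n$ over a universe of size $u$ with sustained false-positive rate $\varepsilon$ regardless of the history, there is a (deterministic) adversary against which the AMQ uses at least $B(n,u)$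 bits of space with probability at least $1-1/n$. -/

import Mathlib

open MeasureTheory

/-- The private infinite random string `ρ` of a filter. -/
abbrev Coins := ℕ → Bool

/-- The uniform distribution on infinite bit strings (independent fair coins). -/
noncomputable def coinMeasure : Measure Coins :=
  Measure.infinitePi (fun _ : ℕ => (PMF.uniformOfFintype Bool).toMeasure)

/-- An internal state of a filter: the local bit string and the remote bit string. -/
abbrev BitState := List Bool × List Bool

/-- The deterministic functions that make up a filter over the universe `Fin u`, for fixed values
of the capacity and of the target false-positive rate.  The answer `true` stands for "present",
`false` for "absent".  A lookup sees only the local string; `update` is called on false positives.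
The last five fields say that every function depends measurably on the random string. -/
structure AMQFunctions (u : ℕ) where
  build : Coins → BitState
  lookup : List Bool → Fin u → Coins → List Bool × Bool
  insert : BitState → Fin u → Coins → BitState
  delete : BitState → Fin u → Coins → BitState
  update : BitState → Fin u → Coins → BitState
  measurable_build : ∀ t, MeasurableSet {ρ | build ρ = t}
  measurable_lookup : ∀ l x t, MeasurableSet {ρ | lookup l x ρ = t}
  measurable_insert : ∀ s x t, MeasurableSet {ρ | insert s x ρ = t}
  measurable_delete : ∀ s x t, MeasurableSet {ρ | delete s x ρ = t}
  measurable_update : ∀ s x t, MeasurableSet {ρ | update s x ρ = t}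

/-- The state of the oracle: the set currently represented, and the state of the filter. -/
structure OracleState (u : ℕ) where
  S : Finset (Fin u)
  state : BitState

/-- Number of bits (local and remote) stored by the filter. -/
def OracleState.space {u : ℕ} (σ : OracleState u) : ℕ :=
  σ.state.1.length + σ.state.2.length

/-- A deterministic adaptive adversary, as a decision tree.  It issues insertions, deletions and
lookups; it sees the answers to its lookups and nothing else; finally it outputs an element. -/
inductive Adversary (u : ℕ) where
  | output (x : Fin u) : Adversary u
  | insert (x : Fin u) (next : Adversary u) : Adversary u
  | delete (x : Fin u) (next : Adversary u) : Adversary u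
  | lookup (x : Fin u) (next : Bool → Adversary u) : Adversary u

namespace AMQFunctions

variable {u : ℕ} (F : AMQFunctions u) (n : ℕ) (ρ : Coins)

/-- The oracle after set-up. -/
def start : OracleState u := ⟨∅, F.build ρ⟩

/-- Insertion through the oracle; requests that overload the filter, or that insert an element
which is already there, are ignored. -/
def oracleInsert (σ : OracleState u) (x : Fin u) : OracleState u :=
  if σ.S.card < n ∧ x ∉ σ.S then ⟨Insert.insert x σ.S, F.insert σ.state x ρ⟩ else σ

/-- Deletion through the oracle; requests to delete an absent element are ignored. -/
def oracleDelete (σ : OracleState u) (x : Fin u) : OracleState u :=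
  if x ∈ σ.S then ⟨σ.S.erase x, F.delete σ.state x ρ⟩ else σ

/-- The answer to a lookup. -/
def answer (σ : OracleState u) (x : Fin u) : Bool := (F.lookup σ.state.1 x ρ).2

/-- Lookup through the oracle: the lookup may change the local string, and then, if the answer
was a false positive, the filter is told so and may update its whole state. -/
def oracleLookup (σ : OracleState u) (x : Fin u) : OracleState u :=
  let s : BitState := ((F.lookup σ.state.1 x ρ).1, σ.state.2)
  if F.answer ρ σ x = true ∧ x ∉ σ.S then ⟨σ.S, F.update s x ρ⟩ else ⟨σ.S, s⟩

/-- The oracle states that can occur, for the random string `ρ`. -/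
inductive Reachable : OracleState u → Prop
  | start : Reachable (F.start ρ)
  | insert (σ : OracleState u) (x : Fin u) : Reachable σ → Reachable (F.oracleInsert n ρ σ x)
  | delete (σ : OracleState u) (x : Fin u) : Reachable σ → Reachable (F.oracleDelete ρ σ x)
  | lookup (σ : OracleState u) (x : Fin u) : Reachable σ → Reachable (F.oracleLookup ρ σ x)

/-- The adversary, started when the oracle is in a given state, wins: its output is a false
positive of the final state. -/
def winsFrom : Adversary u → OracleState u → Prop
  | .output x, σ => F.answer ρ σ x = true ∧ x ∉ σ.S
  | .insert x next, σ => winsFrom next (F.oracleInsert n ρ σ x)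
  | .delete x next, σ => winsFrom next (F.oracleDelete ρ σ x)
  | .lookup x next, σ => winsFrom (next (F.answer ρ σ x)) (F.oracleLookup ρ σ x)

/-- The answers that the adversary sees before it produces its output. -/
def answersFrom : Adversary u → OracleState u → List Bool
  | .output _, _ => []
  | .insert x next, σ => answersFrom next (F.oracleInsert n ρ σ x)
  | .delete x next, σ => answersFrom next (F.oracleDelete ρ σ x)
  | .lookup x next, σ =>
      F.answer ρ σ x :: answersFrom (next (F.answer ρ σ x)) (F.oracleLookup ρ σ x)

/-- The largest number of bits held by the filter at any time between operations of the run. -/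
def peakFrom : Adversary u → OracleState u → ℕ
  | .output _, σ => σ.space
  | .insert x next, σ => max σ.space (peakFrom next (F.oracleInsert n ρ σ x))
  | .delete x next, σ => max σ.space (peakFrom next (F.oracleDelete ρ σ x))
  | .lookup x next, σ =>
      max σ.space (peakFrom (next (F.answer ρ σ x)) (F.oracleLookup ρ σ x))

end AMQFunctions

/-- An approximate membership query data structure of capacity `n` over `Fin u`: there are no
false negatives, whatever operations have been performed. -/
structure AMQ (u n : ℕ) extends AMQFunctions u where
  no_false_negatives : ∀ (ρ : Coins) (σ : OracleState u), toAMQFunctions.Reachable n ρ σ →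
    ∀ x ∈ σ.S, toAMQFunctions.answer ρ σ x = true

namespace AMQ

variable {u n : ℕ} (A : AMQ u n)

/-- The adversary wins the adaptivity game. -/
def Wins (adv : Adversary u) (ρ : Coins) : Prop :=
  A.winsFrom n ρ adv (A.start ρ)

/-- The sequence of answers seen by the adversary in the adaptivity game. -/
def answers (adv : Adversary u) (ρ : Coins) : List Bool :=
  A.answersFrom n ρ adv (A.start ρ)

/-- The peak number of bits used by the filter in the adaptivity game. -/
def peakSpace (adv : Adversary u) (ρ : Coins) : ℕ :=
  A.peakFrom n ρ adv (A.start ρ)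

/-- Sustained false-positive rate `ε`: no adversary wins with probability greater than `ε`.
(A randomized adversary is a mixture of deterministic ones, so deterministic ones suffice.) -/
def SustainedRate (ε : ℝ) : Prop :=
  ∀ adv : Adversary u, coinMeasure.real {ρ | A.Wins adv ρ} ≤ ε

/-- Sustained false-positive rate `ε` regardless of the history: for every adversary and every
sequence `h` of answers, the probability of a win conditioned on having seen `h` is at most `ε`. -/
def SustainedRateGivenHistory (ε : ℝ) : Prop :=
  ∀ (adv : Adversary u) (h : List Bool),
    coinMeasure.real {ρ | A.Wins adv ρ ∧ A.answers adv ρ = h} ≤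
      ε * coinMeasure.real {ρ | A.answers adv ρ = h}

end AMQ

/-!
The bound holds even with `n * logb 2 n / 480` in place of the minimum, so the constant does not
depend on the rate.

The adversary inserts a random tuple `s` of `n` elements, fixes a random tuple `q` of
`m ≈ n ^ (17 / 12)` queries, and regards all of them as candidates.  It looks up random candidates,
drops a candidate when the answer is negative, and finally outputs a random candidate.

Fix the random string, and call a state small if it has fewer than `n * logb 2 n / 480` bits.  After
the insertions, a small state leaves a dense set of tuples possible for `s`, because there are few
small states.  Hence the elements that are popular in these tuples have density `n ^ (-1 / 12)` or
more (`card_le_of_popular_small`).  From then on, the evolution of the filter is the same for all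
possible tuples that miss `q`, since each positive answer is reported to be false.  By the absence
of false negatives, each later state has to answer positively on all of these tuples, and so it
excludes only a very small part of the popular elements (`card_mul_card_le_of_popular`).  The number
of small states is too small for any of them to exclude more than `n` of the random queries in this
way, while far more than `n` queries are popular (`card_excludable_le`).

So there is a large set `D` of queries of which every small state that occurs excludes at most `n`.
The queries in `D` are therefore hardly ever dropped: an exponential potential shows that half of
`D` survives `m * K` lookups, except with tiny probability (`sum_potential_remaining_le`).  Since each
negative answer drops one of the `m` candidates, at most a fraction `1 / K` of the answers is
negative as long as the states remain small.  If the length of the attack is random, this makes the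
final output a false positive with probability close to one (`sum_attackMean_fail_le`), and the
sustained rate bounds the probability of small states.  If the rate holds regardless of the
history, then a run of `m * K` lookups with only `m` negative answers is exponentially unlikely
(`RateGivenHistoryFrom.measureReal_count_le`), and so are small states, except for the probability
of an unlucky choice of `s` and `q` (`attackMean_few_positive_le`).

In all cases the failure probability is averaged over the random choices of the adversary for each
fixed random string, the average is exchanged with the coin measure, and a deterministic adversary
that is at least as good as the average is extracted (`exists_integral_le_of_sum_attackMean_le`).
-/

/-! ### Counting tuples -/

section Counting

variable {U : Type*} [Fintype U] [DecidableEq U]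

/-- Union bound over the `r` coordinates that lie in `X`. -/
theorem card_many_hits (X : Finset U) (m r : ℕ) :
    (Finset.univ.filter fun g : Fin m → U =>
        r ≤ (Finset.univ.filter fun j => g j ∈ X).card).card
      ≤ m.choose r * (X.card ^ r * Fintype.card U ^ (m - r)) := by
  classical
  have hsub : (Finset.univ.filter fun g : Fin m → U =>
        r ≤ (Finset.univ.filter fun j => g j ∈ X).card) ⊆
      (Finset.powersetCard r (Finset.univ : Finset (Fin m))).biUnion fun J =>
        Fintype.piFinset fun j => if j ∈ J then X else Finset.univ := by
    intro g hg
    simp only [Finset.mem_filter, Finset.mem_univ, true_and] at hg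
    obtain ⟨J, hJ, hJc⟩ := Finset.exists_subset_card_eq hg
    simp only [Finset.mem_biUnion, Finset.mem_powersetCard, Finset.subset_univ, true_and,
      Fintype.mem_piFinset]
    refine ⟨J, hJc, fun j => ?_⟩
    split_ifs with h
    · simpa using hJ h
    · simp
  refine (Finset.card_le_card hsub).trans ?_
  refine (Finset.card_biUnion_le_card_mul _ _ (X.card ^ r * Fintype.card U ^ (m - r)) ?_).trans ?_
  · intro J hJ
    rw [Finset.mem_powersetCard] at hJ
    have h1 : ∀ j, (if j ∈ J then X else Finset.univ).card
        = if j ∈ J then X.card else Fintype.card U := by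
      intro j; split_ifs <;> simp
    simp only [Fintype.card_piFinset, h1]
    rw [Finset.prod_ite]
    simp only [Finset.prod_const]
    have h2 : (Finset.univ.filter fun j => j ∈ J) = J := by ext; simp
    have h3 : (Finset.univ.filter fun j => j ∉ J) = Jᶜ := by ext; simp
    rw [h2, h3, Finset.card_compl, Fintype.card_fin, hJ.2]
  · simp

theorem card_many_hits_le (X : Finset U) (m r : ℕ) {κ : ℝ}
    (hX : (X.card : ℝ) ≤ κ * Fintype.card U) (hr : r ≤ m) :
    ((Finset.univ.filter fun g : Fin m → U =>
        r ≤ (Finset.univ.filter fun j => g j ∈ X).card).card : ℝ)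
      ≤ m.choose r * κ ^ r * (Fintype.card U : ℝ) ^ m := by
  have h := card_many_hits X m r
  have h' : ((Finset.univ.filter fun g : Fin m → U =>
        r ≤ (Finset.univ.filter fun j => g j ∈ X).card).card : ℝ)
      ≤ m.choose r * ((X.card : ℝ) ^ r * (Fintype.card U : ℝ) ^ (m - r)) := by exact_mod_cast h
  refine h'.trans ?_
  have h4 : (X.card : ℝ) ^ r ≤ (κ * Fintype.card U) ^ r := by gcongr
  calc (m.choose r : ℝ) * ((X.card : ℝ) ^ r * (Fintype.card U : ℝ) ^ (m - r))
      ≤ m.choose r * ((κ * Fintype.card U) ^ r * (Fintype.card U : ℝ) ^ (m - r)) := by gcongr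
    _ = m.choose r * κ ^ r * ((Fintype.card U : ℝ) ^ r * (Fintype.card U : ℝ) ^ (m - r)) := by
        rw [mul_pow]; ring
    _ = _ := by rw [← pow_add, Nat.add_sub_cancel' hr]

theorem card_hitting {n m : ℕ} (s : Fin n → U) (hm : 1 ≤ m) :
    ((Finset.univ.filter fun Q : Fin m → U => ∃ i j, s i = Q j).card : ℝ) * Fintype.card U
      ≤ n * m * (Fintype.card U : ℝ) ^ m := by
  have h := card_many_hits (Finset.univ.image s) m 1
  have hsub : (Finset.univ.filter fun Q : Fin m → U => ∃ i j, s i = Q j) ⊆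
      (Finset.univ.filter fun g : Fin m → U =>
        1 ≤ (Finset.univ.filter fun j => g j ∈ Finset.univ.image s).card) := by
    intro Q
    simp only [Finset.mem_filter, Finset.mem_univ, true_and, Finset.one_le_card]
    rintro ⟨i, j, hij⟩
    exact ⟨j, by simp [← hij]⟩
  have h2 := (Finset.card_le_card hsub).trans h
  have h3 : (Finset.univ.image s).card ≤ n := Finset.card_image_le.trans (by simp)
  have h4 : (Finset.univ.filter fun Q : Fin m → U => ∃ i j, s i = Q j).card * Fintype.card U
      ≤ n * m * Fintype.card U ^ m := by
    calc _ ≤ (m.choose 1 * ((Finset.univ.image s).card ^ 1 * Fintype.card U ^ (m - 1)))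
          * Fintype.card U := Nat.mul_le_mul_right _ h2
      _ ≤ (m * (n * Fintype.card U ^ (m - 1))) * Fintype.card U := by
          simp only [Nat.choose_one_right, pow_one]; gcongr
      _ = n * m * (Fintype.card U ^ (m - 1) * Fintype.card U) := by ring
      _ = _ := by rw [← pow_succ, Nat.sub_add_cancel hm]
  exact_mod_cast h4

/-- The number of occurrences of `x` as a coordinate of the tuples of `F`. -/
def occurrences {U : Type*} [DecidableEq U] {n : ℕ} (F : Finset (Fin n → U)) (x : U) : ℕ :=
  ∑ s ∈ F, (Finset.univ.filter fun i => s i = x).card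

/-- The elements that occur in the tuples of `F` at least a quarter as often as on average. -/
def popular {n : ℕ} (F : Finset (Fin n → U)) : Finset U :=
  Finset.univ.filter fun x => n * F.card ≤ 4 * Fintype.card U * occurrences F x

theorem sum_occurrences {U : Type*} [DecidableEq U] {n : ℕ} (F : Finset (Fin n → U)) (X : Finset U) :
    ∑ x ∈ X, occurrences F x = ∑ s ∈ F, (Finset.univ.filter fun i => s i ∈ X).card := by
  unfold occurrences
  rw [Finset.sum_comm]
  refine Finset.sum_congr rfl fun s _ => ?_
  rw [Finset.card_eq_sum_card_fiberwise (f := s) (t := X)]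
  · refine Finset.sum_congr rfl fun x hx => ?_
    congr 1
    ext i
    simp only [Finset.mem_filter, Finset.mem_univ, true_and]
    constructor
    · intro h; exact ⟨h ▸ hx, h⟩
    · exact fun h => h.2
  · intro i hi
    simpa using hi

/-- A set of tuples with few popular elements is sparse: at most a quarter of all coordinates are
unpopular, so half of the tuples have half of their coordinates among the popular elements. -/
theorem card_le_of_popular_small {n : ℕ} (F : Finset (Fin n → U)) {κ : ℝ}
    (hu : 0 < Fintype.card U) (hW : ((popular F).card : ℝ) ≤ κ * Fintype.card U) (hn : 0 < n)
    (hκ : 0 ≤ κ) :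
    (F.card : ℝ) ≤ 2 * 2 ^ n * κ ^ (n / 2) * (Fintype.card U : ℝ) ^ n := by
  classical
  set W := popular F with hWdef
  -- `G` holds the tuples with half of their coordinates popular.
  set G := F.filter fun s => n / 2 ≤ (Finset.univ.filter fun i => s i ∈ W).card with hG
  set H := F.filter fun s => ¬ n / 2 ≤ (Finset.univ.filter fun i => s i ∈ W).card with hH
  have hcard : G.card + H.card = F.card := Finset.card_filter_add_card_filter_not _
  have hout : 4 * Fintype.card U * ∑ x ∈ Wᶜ, occurrences F x ≤ Fintype.card U * (n * F.card) := by
    rw [Finset.mul_sum]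
    calc _ ≤ ∑ x ∈ Wᶜ, n * F.card := by
          refine Finset.sum_le_sum fun x hx => ?_
          simp only [hWdef, popular, Finset.mem_compl, Finset.mem_filter, Finset.mem_univ,
            true_and, not_le] at hx
          exact hx.le
      _ ≤ _ := by
          rw [Finset.sum_const, smul_eq_mul]
          exact Nat.mul_le_mul_right _ (Finset.card_le_univ _)
  have hout' : 4 * ∑ x ∈ Wᶜ, occurrences F x ≤ n * F.card := by
    refine Nat.le_of_mul_le_mul_left ?_ hu
    calc _ = 4 * Fintype.card U * ∑ x ∈ Wᶜ, occurrences F x := by ring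
      _ ≤ _ := hout
  rw [sum_occurrences] at hout'
  have hHle : n * H.card ≤ 2 * ∑ s ∈ F, (Finset.univ.filter fun i => s i ∈ Wᶜ).card := by
    calc n * H.card = ∑ s ∈ H, n := by simp [mul_comm]
      _ ≤ ∑ s ∈ H, 2 * (Finset.univ.filter fun i => s i ∈ Wᶜ).card := by
          refine Finset.sum_le_sum fun s hs => ?_
          have h1 := (Finset.mem_filter.1 hs).2
          have h2 : (Finset.univ.filter fun i => s i ∈ W).card
              + (Finset.univ.filter fun i => s i ∈ Wᶜ).card = n := by
            have := Finset.card_filter_add_card_filter_not (s := (Finset.univ : Finset (Fin n)))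
              (fun i => s i ∈ W)
            simpa using this
          omega
      _ ≤ ∑ s ∈ F, 2 * (Finset.univ.filter fun i => s i ∈ Wᶜ).card :=
          Finset.sum_le_sum_of_subset (Finset.filter_subset _ _)
      _ = _ := by rw [Finset.mul_sum]
  have h2H : 2 * H.card ≤ F.card := by
    refine Nat.le_of_mul_le_mul_left ?_ hn
    calc n * (2 * H.card) = 2 * (n * H.card) := by ring
      _ ≤ 4 * ∑ s ∈ F, (Finset.univ.filter fun i => s i ∈ Wᶜ).card := by omega
      _ ≤ _ := hout'
  have hGle : (G.card : ℝ) ≤ n.choose (n / 2) * κ ^ (n / 2) * (Fintype.card U : ℝ) ^ n := by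
    refine le_trans ?_ (card_many_hits_le W n (n / 2) hW (Nat.div_le_self _ _))
    exact_mod_cast Finset.card_le_card (Finset.filter_subset_filter _ (Finset.subset_univ _))
  have hc : (n.choose (n / 2) : ℝ) ≤ 2 ^ n := by exact_mod_cast Nat.choose_le_two_pow _ _
  have hFG : (F.card : ℝ) ≤ 2 * G.card := by
    have : F.card ≤ 2 * G.card := by omega
    exact_mod_cast this
  calc (F.card : ℝ) ≤ 2 * G.card := hFG
    _ ≤ 2 * (2 ^ n * κ ^ (n / 2) * (Fintype.card U : ℝ) ^ n) := by
        gcongr; exact hGle.trans (by gcongr)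
    _ = _ := by ring

/-- If the tuples of `F` that miss `Q` also miss a set `X` of popular elements, then `X` is small
unless `Q` hits many of the tuples of `F`. -/
theorem card_mul_card_le_of_popular {n m : ℕ} (F : Finset (Fin n → U)) (Q : Fin m → U)
    (X : Finset U) (hX : X ⊆ popular F) (hn : 0 < n)
    (hQ : ∀ s ∈ F, (∀ i j, s i ≠ Q j) → ∀ i, s i ∉ X) :
    X.card * F.card ≤ 4 * Fintype.card U * (F.filter fun s => ∃ i j, s i = Q j).card := by
  classical
  refine Nat.le_of_mul_le_mul_left ?_ hn
  calc n * (X.card * F.card) = ∑ x ∈ X, n * F.card := by simp; ring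
    _ ≤ ∑ x ∈ X, 4 * Fintype.card U * occurrences F x := by
        refine Finset.sum_le_sum fun x hx => ?_
        simpa [popular] using hX hx
    _ = 4 * Fintype.card U * ∑ s ∈ F, (Finset.univ.filter fun i => s i ∈ X).card := by
        rw [← Finset.mul_sum, sum_occurrences]
    _ ≤ 4 * Fintype.card U * ∑ s ∈ F, (if ∃ i j, s i = Q j then n else 0) := by
        gcongr with s hs
        split_ifs with h
        · exact (Finset.card_le_univ _).trans (by simp)
        · push Not at h
          simp [hQ s hs h]
    _ = n * (4 * Fintype.card U * (F.filter fun s => ∃ i j, s i = Q j).card) := by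
        rw [← Finset.sum_filter]; simp; ring

end Counting

/-! ### Most queries cannot be excluded by few states -/

section Unexcludable

variable {U : Type*} [Fintype U] [DecidableEq U]

theorem card_pairs_hitting_le {n m : ℕ} {η : ℝ} (hm : 1 ≤ m) (hu : 0 < Fintype.card U)
    (h5 : (n * m : ℝ) ≤ η * Fintype.card U) :
    ((Finset.univ.filter fun sQ : (Fin n → U) × (Fin m → U) =>
        ∃ i j, sQ.1 i = sQ.2 j).card : ℝ)
      ≤ η * ((Fintype.card U : ℝ) ^ n * (Fintype.card U : ℝ) ^ m) := by
  have hu' : (0 : ℝ) < Fintype.card U := by exact_mod_cast hu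
  have h : ((Finset.univ.filter fun sQ : (Fin n → U) × (Fin m → U) =>
        ∃ i j, sQ.1 i = sQ.2 j).card : ℝ) = ∑ s : Fin n → U,
      ((Finset.univ.filter fun Q : Fin m → U => ∃ i j, s i = Q j).card : ℝ) := by
    simp only [Finset.card_filter, Nat.cast_sum]
    rw [Fintype.sum_prod_type]
  refine le_of_mul_le_mul_right ?_ hu'
  rw [h, Finset.sum_mul]
  calc _ ≤ ∑ s : Fin n → U, (n * m * (Fintype.card U : ℝ) ^ m) :=
        Finset.sum_le_sum fun s _ => card_hitting s hm
    _ = (n * m) * ((Fintype.card U : ℝ) ^ n * (Fintype.card U : ℝ) ^ m) := by simp; ring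
    _ ≤ (η * Fintype.card U) * ((Fintype.card U : ℝ) ^ n * (Fintype.card U : ℝ) ^ m) := by gcongr
    _ = _ := by ring

/-- Random queries rarely hit a noticeable fraction of a fixed set `F` of tuples: Markov's
inequality for the expected number of tuples hit. -/
theorem card_fat_le {n m : ℕ} (F : Finset (Fin n → U)) {η ξ : ℝ} (hF : 0 < F.card)
    (hξ : 0 < ξ) (hm : 1 ≤ m) (hu : 0 < Fintype.card U)
    (h4 : 4 * (n * m : ℝ) ≤ η * (ξ * Fintype.card U)) :
    ((Finset.univ.filter fun Q : Fin m → U =>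
        ξ * F.card < 4 * (F.filter fun s => ∃ i j, s i = Q j).card).card : ℝ)
      ≤ η * (Fintype.card U : ℝ) ^ m := by
  classical
  set B := Finset.univ.filter fun Q : Fin m → U =>
        ξ * F.card < 4 * (F.filter fun s => ∃ i j, s i = Q j).card with hB
  have hu' : (0 : ℝ) < Fintype.card U := by exact_mod_cast hu
  have hF' : (0 : ℝ) < F.card := by exact_mod_cast hF
  have h1 : (B.card : ℝ) * (ξ * F.card)
      ≤ 4 * ∑ Q : Fin m → U, ((F.filter fun s => ∃ i j, s i = Q j).card : ℝ) := by
    rw [Finset.mul_sum]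
    calc (B.card : ℝ) * (ξ * F.card) = ∑ Q ∈ B, ξ * F.card := by simp
      _ ≤ ∑ Q ∈ B, 4 * ((F.filter fun s => ∃ i j, s i = Q j).card : ℝ) :=
          Finset.sum_le_sum fun Q hQ => (Finset.mem_filter.1 hQ).2.le
      _ ≤ _ := Finset.sum_le_sum_of_subset_of_nonneg (Finset.subset_univ _)
          fun _ _ _ => by positivity
  have h2 : (∑ Q : Fin m → U, ((F.filter fun s => ∃ i j, s i = Q j).card : ℝ))
        * Fintype.card U ≤ F.card * (n * m * (Fintype.card U : ℝ) ^ m) := by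
    have h3 : ∑ Q : Fin m → U, ((F.filter fun s => ∃ i j, s i = Q j).card : ℝ)
        = ∑ s ∈ F, ((Finset.univ.filter fun Q : Fin m → U => ∃ i j, s i = Q j).card : ℝ) := by
      simp only [Finset.card_filter, Nat.cast_sum]
      exact Finset.sum_comm
    rw [h3, Finset.sum_mul]
    calc _ ≤ ∑ s ∈ F, (n * m * (Fintype.card U : ℝ) ^ m) :=
          Finset.sum_le_sum fun s _ => card_hitting s hm
      _ = _ := by simp
  have h5 : (B.card : ℝ) * (ξ * F.card * Fintype.card U)
      ≤ (η * (Fintype.card U : ℝ) ^ m) * (ξ * F.card * Fintype.card U) := by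
    calc (B.card : ℝ) * (ξ * F.card * Fintype.card U)
        = (B.card : ℝ) * (ξ * F.card) * Fintype.card U := by ring
      _ ≤ 4 * (∑ Q : Fin m → U, ((F.filter fun s => ∃ i j, s i = Q j).card : ℝ))
            * Fintype.card U := by gcongr
      _ ≤ 4 * (F.card * (n * m * (Fintype.card U : ℝ) ^ m)) := by linarith
      _ = (4 * (n * m)) * (F.card * (Fintype.card U : ℝ) ^ m) := by ring
      _ ≤ (η * (ξ * Fintype.card U)) * (F.card * (Fintype.card U : ℝ) ^ m) := by gcongr
      _ = _ := by ring
  exact le_of_mul_le_mul_right h5 (by positivity)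

/-- For a fixed set `F` of candidate tuples, three things may be wrong with queries `Q`: few of
them are popular in `F`; some state excludes a set of popular elements that is small but contains
many of the queries; or the queries hit many tuples of `F`.  Each is rare, the second by a union
bound over the states. -/
theorem card_bad_queries_le {n m d r : ℕ} {Y : Type*} (F : Finset (Fin n → U))
    (states : Finset Y) (P : Y → Finset U) {N η κ ξ : ℝ}
    (hN : (states.card : ℝ) ≤ N) (hF : 0 < F.card)
    (hW : κ * Fintype.card U < (popular F).card)
    (hξ : 0 < ξ) (hm : 1 ≤ m) (hu : 0 < Fintype.card U) (hd : d ≤ m) (hr : r ≤ m)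
    (h2 : m.choose (m - d) * (1 - κ) ^ (m - d) ≤ η)
    (h3 : N * (m.choose r * ξ ^ r) ≤ η)
    (h4 : 4 * (n * m : ℝ) ≤ η * (ξ * Fintype.card U)) :
    ((Finset.univ.filter fun Q : Fin m → U =>
        (Finset.univ.filter fun j => Q j ∈ popular F).card < d ∨
        (∃ z ∈ states, ((popular F \ P z).card : ℝ) ≤ ξ * Fintype.card U ∧
          r ≤ (Finset.univ.filter fun j => Q j ∈ popular F \ P z).card) ∨
        ξ * F.card < 4 * (F.filter fun s => ∃ i j, s i = Q j).card).card : ℝ)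
      ≤ 3 * η * (Fintype.card U : ℝ) ^ m := by
  classical
  set W := popular F
  have e1 : ((Finset.univ.filter fun Q : Fin m → U =>
        (Finset.univ.filter fun j => Q j ∈ W).card < d).card : ℝ)
      ≤ η * (Fintype.card U : ℝ) ^ m := by
    have hc : ((Wᶜ).card : ℝ) ≤ (1 - κ) * Fintype.card U := by
      have : W.card + (Wᶜ).card = Fintype.card U := Finset.card_add_card_compl _
      have : (W.card : ℝ) + (Wᶜ).card = Fintype.card U := by exact_mod_cast this
      linarith
    have h := card_many_hits_le (Wᶜ) m (m - d) hc (Nat.sub_le _ _)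
    refine le_trans ?_ (h.trans (by gcongr))
    have hsub : (Finset.univ.filter fun Q : Fin m → U =>
        (Finset.univ.filter fun j => Q j ∈ W).card < d) ⊆
        (Finset.univ.filter fun Q : Fin m → U =>
          m - d ≤ (Finset.univ.filter fun j => Q j ∈ Wᶜ).card) := by
      intro Q
      simp only [Finset.mem_filter, Finset.mem_univ, true_and, Finset.mem_compl]
      intro hQ
      have := Finset.card_filter_add_card_filter_not (s := (Finset.univ : Finset (Fin m)))
              (fun i => Q i ∈ W)
      simp only [Finset.card_univ, Fintype.card_fin] at this
      omega
    exact_mod_cast Finset.card_le_card hsub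
  have e2 : ((Finset.univ.filter fun Q : Fin m → U =>
        ∃ z ∈ states, ((W \ P z).card : ℝ) ≤ ξ * Fintype.card U ∧
          r ≤ (Finset.univ.filter fun j => Q j ∈ W \ P z).card).card : ℝ)
      ≤ η * (Fintype.card U : ℝ) ^ m := by
    set S' := states.filter fun z => ((W \ P z).card : ℝ) ≤ ξ * Fintype.card U
    have hsub : (Finset.univ.filter fun Q : Fin m → U =>
        ∃ z ∈ states, ((W \ P z).card : ℝ) ≤ ξ * Fintype.card U ∧
          r ≤ (Finset.univ.filter fun j => Q j ∈ W \ P z).card) ⊆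
        S'.biUnion fun z => Finset.univ.filter fun Q : Fin m → U =>
          r ≤ (Finset.univ.filter fun j => Q j ∈ W \ P z).card := by
      intro Q hQ
      obtain ⟨z, hz, hz1, hz2⟩ := (Finset.mem_filter.1 hQ).2
      exact Finset.mem_biUnion.2 ⟨z, Finset.mem_filter.2 ⟨hz, hz1⟩, by simpa using hz2⟩
    have hle : ((Finset.univ.filter fun Q : Fin m → U =>
        ∃ z ∈ states, ((W \ P z).card : ℝ) ≤ ξ * Fintype.card U ∧
          r ≤ (Finset.univ.filter fun j => Q j ∈ W \ P z).card).card : ℝ) ≤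
        ∑ z ∈ S', ((Finset.univ.filter fun Q : Fin m → U =>
          r ≤ (Finset.univ.filter fun j => Q j ∈ W \ P z).card).card : ℝ) := by
      exact_mod_cast (Finset.card_le_card hsub).trans Finset.card_biUnion_le
    calc _ ≤ _ := hle
      _ ≤ ∑ z ∈ S', (m.choose r * ξ ^ r * (Fintype.card U : ℝ) ^ m) :=
          Finset.sum_le_sum fun z hz => card_many_hits_le _ m r (Finset.mem_filter.1 hz).2 hr
      _ = S'.card * (m.choose r * ξ ^ r * (Fintype.card U : ℝ) ^ m) := by simp
      _ ≤ N * (m.choose r * ξ ^ r * (Fintype.card U : ℝ) ^ m) := by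
          gcongr
          refine le_trans ?_ hN
          exact_mod_cast Finset.card_le_card (Finset.filter_subset _ _)
      _ = N * (m.choose r * ξ ^ r) * (Fintype.card U : ℝ) ^ m := by ring
      _ ≤ _ := by gcongr
  have e3 := card_fat_le (m := m) F hF hξ hm hu h4
  have hcup := fun (p q t : (Fin m → U) → Prop) [DecidablePred p] [DecidablePred q]
      [DecidablePred t] => show ((Finset.univ.filter fun Q => p Q ∨ q Q ∨ t Q).card : ℝ) ≤
        (Finset.univ.filter p).card + ((Finset.univ.filter q).card + (Finset.univ.filter t).card)
      from by
    rw [Finset.filter_or, Finset.filter_or]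
    have a := Finset.card_union_le (Finset.univ.filter p)
      (Finset.univ.filter q ∪ Finset.univ.filter t)
    have b := Finset.card_union_le (Finset.univ.filter q) (Finset.univ.filter t)
    exact_mod_cast a.trans (Nat.add_le_add_left b _)
  refine (hcup _ _ _).trans ?_
  linarith

/-- A tuple `s` is turned into one of few states `f s`; then, depending on `f s` and on queries
`Q` but not otherwise on `s`, states `z ∈ R (f s) Q` occur whose positive set `P z` must contain
`s` as long as `Q` misses `s`.  For most pairs `(s, Q)` there are many queries `D` of which every
state that occurs excludes only few: the candidates for `s` that remain possible after `f s` is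
known cover a large set, of which the state may exclude little, and there are too few states
for them to be adapted to the random queries in that set. -/
theorem card_excludable_le {n m d r : ℕ} {Y : Type*} [DecidableEq Y] (f : (Fin n → U) → Y)
    (states : Finset Y) (P : Y → Finset U) (R : Y → (Fin m → U) → Set Y) {N η κ ξ : ℝ}
    (hR : ∀ s Q z, (∀ i j, s i ≠ Q j) → z ∈ R (f s) Q → ∀ i, s i ∈ P z)
    (hN : (states.card : ℝ) ≤ N) (hN0 : 0 < N) (hη : 0 < η) (hκ : 0 ≤ κ)
    (hξ : 0 < ξ) (hn : 0 < n) (hm : 1 ≤ m) (hu : 0 < Fintype.card U) (hd : d ≤ m) (hr : r ≤ m)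
    (h1 : 2 * 2 ^ n * κ ^ (n / 2) * N < η)
    (h2 : m.choose (m - d) * (1 - κ) ^ (m - d) ≤ η)
    (h3 : N * (m.choose r * ξ ^ r) ≤ η)
    (h4 : 4 * (n * m : ℝ) ≤ η * (ξ * Fintype.card U))
    (h5 : (n * m : ℝ) ≤ η * Fintype.card U)
    (good : (Fin n → U) → (Fin m → U) → Prop)
    (hgood : ∀ s Q, (∀ i j, s i ≠ Q j) →
      (∃ D : Finset (Fin m), d ≤ D.card ∧ ∀ z ∈ R (f s) Q, z ∈ states →
        (D.filter fun j => Q j ∉ P z).card ≤ r) → good s Q) [∀ s Q, Decidable (good s Q)] :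
    ((Finset.univ.filter fun sQ : (Fin n → U) × (Fin m → U) =>
        f sQ.1 ∈ states ∧ ¬ good sQ.1 sQ.2).card : ℝ)
      ≤ 5 * η * ((Fintype.card U : ℝ) ^ n * (Fintype.card U : ℝ) ^ m) := by
  classical
  set u : ℝ := (Fintype.card U : ℝ) with hu_def
  have hu' : 0 < u := by simpa [hu_def] using hu
  -- The fibres of `f`, the exceptional queries of each, and the fibres that are not negligible.
  set F : Y → Finset (Fin n → U) := fun y => Finset.univ.filter fun s => f s = y with hF
  set BQ : Y → Finset (Fin m → U) := fun y => Finset.univ.filter fun Q : Fin m → U =>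
        (Finset.univ.filter fun j => Q j ∈ popular (F y)).card < d ∨
        (∃ z ∈ states, ((popular (F y) \ P z).card : ℝ) ≤ ξ * Fintype.card U ∧
          r ≤ (Finset.univ.filter fun j => Q j ∈ popular (F y) \ P z).card) ∨
        ξ * (F y).card < 4 * ((F y).filter fun s => ∃ i j, s i = Q j).card with hBQ
  set heavy : Y → Prop := fun y => η * u ^ n ≤ (F y).card * N with hheavy
  have hcardF : ∀ y, heavy y → 0 < (F y).card := by
    intro y hy
    have : 0 < η * u ^ n := by positivity
    have h : 0 < ((F y).card : ℝ) * N := this.trans_le hy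
    have := pos_of_mul_pos_left h hN0.le
    exact_mod_cast this
  have hBQle : ∀ y, heavy y → ((BQ y).card : ℝ) ≤ 3 * η * u ^ m := by
    intro y hy
    refine card_bad_queries_le (F y) states P hN (hcardF y hy) ?_ hξ hm hu hd hr h2 h3 h4
    by_contra hcon
    push Not at hcon
    have h := card_le_of_popular_small (F y) hu hcon hn hκ
    have h' : ((F y).card : ℝ) * N ≤ 2 * 2 ^ n * κ ^ (n / 2) * u ^ n * N := by gcongr
    have h'' : 2 * 2 ^ n * κ ^ (n / 2) * N * u ^ n < η * u ^ n :=
      mul_lt_mul_of_pos_right h1 (by positivity)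
    have := hy
    simp only [hheavy] at this
    nlinarith
  -- The three reasons why a pair can fail to be good.
  set B1 := Finset.univ.filter fun sQ : (Fin n → U) × (Fin m → U) => ∃ i j, sQ.1 i = sQ.2 j
  set B2 := (Finset.univ.filter fun s : Fin n → U => f s ∈ states ∧ ¬ heavy (f s)) ×ˢ
    (Finset.univ : Finset (Fin m → U))
  set B3 := Finset.univ.filter fun sQ : (Fin n → U) × (Fin m → U) =>
    heavy (f sQ.1) ∧ sQ.2 ∈ BQ (f sQ.1)
  have c1 : (B1.card : ℝ) ≤ η * (u ^ n * u ^ m) := card_pairs_hitting_le hm hu h5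
  have c2 : (B2.card : ℝ) ≤ η * (u ^ n * u ^ m) := by
    have h : ((Finset.univ.filter fun s : Fin n → U => f s ∈ states ∧ ¬ heavy (f s)).card : ℝ)
        ≤ η * u ^ n := by
      have hsub : (Finset.univ.filter fun s : Fin n → U => f s ∈ states ∧ ¬ heavy (f s)) ⊆
          (states.filter fun y => ¬ heavy y).biUnion F := by
        intro s hs
        simp only [Finset.mem_filter, Finset.mem_univ, true_and] at hs
        simp only [Finset.mem_biUnion, Finset.mem_filter, hF, Finset.mem_univ, true_and]
        exact ⟨f s, hs, rfl⟩
      have h6 : ((Finset.univ.filter fun s : Fin n → U => f s ∈ states ∧ ¬ heavy (f s)).card : ℝ)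
          ≤ ∑ y ∈ states.filter (fun y => ¬ heavy y), ((F y).card : ℝ) := by
        exact_mod_cast (Finset.card_le_card hsub).trans Finset.card_biUnion_le
      refine h6.trans ?_
      have h7 : ∀ y ∈ states.filter (fun y => ¬ heavy y), ((F y).card : ℝ) ≤ η * u ^ n / N := by
        intro y hy
        have := (Finset.mem_filter.1 hy).2
        simp only [hheavy, not_le] at this
        rw [le_div_iff₀ hN0]; exact this.le
      refine (Finset.sum_le_sum h7).trans ?_
      rw [Finset.sum_const, nsmul_eq_mul]
      calc _ ≤ N * (η * u ^ n / N) := by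
            gcongr
            refine le_trans ?_ hN
            exact_mod_cast Finset.card_le_card (Finset.filter_subset _ _)
        _ = _ := by field_simp
    have h8 : (B2.card : ℝ) = ((Finset.univ.filter fun s : Fin n → U =>
        f s ∈ states ∧ ¬ heavy (f s)).card : ℝ) * u ^ m := by
      simp [B2, Finset.card_product, hu_def]
    rw [h8]
    calc _ ≤ η * u ^ n * u ^ m := by gcongr
      _ = _ := by ring
  have c3 : (B3.card : ℝ) ≤ 3 * η * (u ^ n * u ^ m) := by
    have h : (B3.card : ℝ) = ∑ s : Fin n → U,
        ((Finset.univ.filter fun Q : Fin m → U => heavy (f s) ∧ Q ∈ BQ (f s)).card : ℝ) := by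
      simp only [B3, Finset.card_filter, Nat.cast_sum]
      rw [Fintype.sum_prod_type]
    rw [h]
    calc _ ≤ ∑ s : Fin n → U, (3 * η * u ^ m) := by
          refine Finset.sum_le_sum fun s _ => ?_
          by_cases hs : heavy (f s)
          · simpa [hs] using hBQle _ hs
          · simp only [hs, false_and, Finset.filter_false, Finset.card_empty, Nat.cast_zero]
            positivity
      _ = _ := by simp [hu_def]; ring
  have hsub : (Finset.univ.filter fun sQ : (Fin n → U) × (Fin m → U) =>
        f sQ.1 ∈ states ∧ ¬ good sQ.1 sQ.2) ⊆ B1 ∪ (B2 ∪ B3) := by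
    rintro ⟨s, Q⟩ hsQ
    simp only [Finset.mem_filter, Finset.mem_univ, true_and] at hsQ
    obtain ⟨hs, hng⟩ := hsQ
    by_contra hcon
    simp only [B1, B2, B3, Finset.mem_union, Finset.mem_filter, Finset.mem_univ, true_and,
      Finset.mem_product, and_true, not_or, not_and, not_exists, not_not, hs] at hcon
    obtain ⟨hdis, hhv, hQ⟩ := hcon
    specialize hQ hhv
    simp only [hBQ, Finset.mem_filter, Finset.mem_univ, true_and, not_or, not_lt, not_exists,
      not_and, not_le] at hQ
    obtain ⟨q1, q2, q3⟩ := hQ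
    refine hng (hgood s Q hdis ⟨Finset.univ.filter fun j => Q j ∈ popular (F (f s)), q1, ?_⟩)
    intro z hz hzs
    -- All tuples of the fibre that miss `Q` stay possible in the state `z`, so `z` cannot exclude
    -- more popular elements than the few tuples hit by `Q` allow.
    have hfat : ((popular (F (f s)) \ P z).card : ℝ) ≤ ξ * Fintype.card U := by
      have h := card_mul_card_le_of_popular (F (f s)) Q (popular (F (f s)) \ P z)
        Finset.sdiff_subset hn (by
          intro s' hs' hdis' i hi
          have hs'' : f s' = f s := by simpa [hF] using hs'
          exact (Finset.mem_sdiff.1 hi).2 (hR s' Q z hdis' (hs'' ▸ hz) i))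
      have h' : ((popular (F (f s)) \ P z).card : ℝ) * (F (f s)).card ≤
          4 * u * ((F (f s)).filter fun s => ∃ i j, s i = Q j).card := by rw [hu_def]; exact_mod_cast h
      have hp : (0 : ℝ) < (F (f s)).card := by exact_mod_cast hcardF _ hhv
      refine le_of_mul_le_mul_right ?_ hp
      calc _ ≤ _ := h'
        _ = u * (4 * ((F (f s)).filter fun s => ∃ i j, s i = Q j).card) := by ring
        _ ≤ u * (ξ * (F (f s)).card) := by gcongr
        _ = _ := by ring
    have := q2 z hzs hfat
    rw [Finset.filter_filter]
    refine le_of_lt (lt_of_eq_of_lt ?_ this)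
    congr 1
    ext j; simp
  have hc : ((Finset.univ.filter fun sQ : (Fin n → U) × (Fin m → U) =>
        f sQ.1 ∈ states ∧ ¬ good sQ.1 sQ.2).card : ℝ) ≤ B1.card + (B2.card + B3.card) := by
    have a := Finset.card_union_le B1 (B2 ∪ B3)
    have b := Finset.card_union_le B2 B3
    exact_mod_cast (Finset.card_le_card hsub).trans (a.trans (Nat.add_le_add_left b _))
  linarith

end Unexcludable

/-! ### The random attack -/

section LookupAttack

variable {u m : ℕ}

/-- The mean of `f` over the random attack with `t` lookups whose set of candidates is `C`:
each lookup is that of `q j` for a uniformly random candidate `j`, which is dropped from the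
candidates if the answer is negative; the output is `q j` for a random remaining candidate.
The attack gives up, with output `x₀`, if no candidate is left.  The attack is not itself
represented: its two continuations after a lookup may be drawn independently, since only one of
them is used. -/
noncomputable def attackMean (q : Fin m → Fin u) (x₀ : Fin u) :
    ℕ → Finset (Fin m) → (Adversary u → ℝ) → ℝ
  | 0, C, f => if C.Nonempty then (∑ j ∈ C, f (.output (q j))) / C.card else f (.output x₀)
  | t + 1, C, f =>
      if C.Nonempty then
        (∑ j ∈ C, attackMean q x₀ t C fun a => attackMean q x₀ t (C.erase j) fun b =>
          f (.lookup (q j) fun r => if r then a else b)) / C.card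
      else f (.output x₀)

/-- The adversary makes at most `t` requests, all of them lookups of elements `q j`. -/
def OnlyLookups (q : Fin m → Fin u) : ℕ → Adversary u → Prop
  | _, .output _ => True
  | t + 1, .lookup x next => (∃ j, x = q j) ∧ ∀ b, OnlyLookups q t (next b)
  | _, _ => False

variable (q : Fin m → Fin u) (x₀ : Fin u)

theorem attackMean_mono (t : ℕ) : ∀ (C : Finset (Fin m)) {f g : Adversary u → ℝ},
    (∀ a, f a ≤ g a) → attackMean q x₀ t C f ≤ attackMean q x₀ t C g := by
  induction t with
  | zero =>
    intro C f g h
    unfold attackMean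
    split_ifs
    · gcongr; exact h _
    · exact h _
  | succ t ih =>
    intro C f g h
    unfold attackMean
    split_ifs
    · gcongr
      exact ih _ fun a => ih _ fun b => h _
    · exact h _

theorem attackMean_const (t : ℕ) : ∀ (C : Finset (Fin m)) (c : ℝ),
    attackMean q x₀ t C (fun _ => c) = c := by
  induction t with
  | zero =>
    intro C c
    unfold attackMean
    split_ifs with hC
    · have : (C.card : ℝ) ≠ 0 := by exact_mod_cast hC.card_pos.ne'
      simp; field_simp
    · rfl
  | succ t ih =>
    intro C c
    unfold attackMean
    split_ifs with hC
    · have : (C.card : ℝ) ≠ 0 := by exact_mod_cast hC.card_pos.ne'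
      simp only [ih]
      simp; field_simp
    · rfl

theorem exists_onlyLookups_le_attackMean (t : ℕ) : ∀ (C : Finset (Fin m)) (f : Adversary u → ℝ),
    ∃ a, OnlyLookups q t a ∧ f a ≤ attackMean q x₀ t C f := by
  induction t with
  | zero =>
    intro C f
    unfold attackMean
    split_ifs with hC
    · have hc : (0 : ℝ) < C.card := by exact_mod_cast hC.card_pos
      obtain ⟨j, -, hj⟩ := Finset.exists_le_of_sum_le (s := C) hC
        (f := fun j => f (.output (q j)))
        (g := fun _ => (∑ j ∈ C, f (.output (q j))) / C.card) (by
          rw [Finset.sum_const, nsmul_eq_mul, mul_div_cancel₀ _ hc.ne'])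
      exact ⟨.output (q j), by simp [OnlyLookups], hj⟩
    · exact ⟨.output x₀, by simp [OnlyLookups], le_rfl⟩
  | succ t ih =>
    intro C f
    unfold attackMean
    split_ifs with hC
    · have hc : (0 : ℝ) < C.card := by exact_mod_cast hC.card_pos
      set φ : Fin m → ℝ := fun j => attackMean q x₀ t C fun a => attackMean q x₀ t (C.erase j)
        fun b => f (.lookup (q j) fun r => if r then a else b) with hφ
      obtain ⟨j, -, hj⟩ := Finset.exists_le_of_sum_le (s := C) hC
        (f := φ) (g := fun _ => (∑ j ∈ C, φ j) / C.card) (by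
          rw [Finset.sum_const, nsmul_eq_mul, mul_div_cancel₀ _ hc.ne'])
      obtain ⟨a, ha, hfa⟩ := ih C fun a => attackMean q x₀ t (C.erase j)
        fun b => f (.lookup (q j) fun r => if r then a else b)
      obtain ⟨b, hb, hfb⟩ := ih (C.erase j)
        fun b => f (.lookup (q j) fun r => if r then a else b)
      refine ⟨.lookup (q j) fun r => if r then a else b, ?_, hfb.trans (hfa.trans hj)⟩
      simp only [OnlyLookups]
      refine ⟨⟨j, rfl⟩, fun r => ?_⟩
      cases r <;> simpa
    · exact ⟨.output x₀, by simp [OnlyLookups], le_rfl⟩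

theorem attackMean_integral {Ω : Type*} [MeasurableSpace Ω] (μ : Measure Ω) (t : ℕ) :
    ∀ (C : Finset (Fin m)) {g : Adversary u → Ω → ℝ}, (∀ a, Integrable (g a) μ) →
      Integrable (fun ω => attackMean q x₀ t C fun a => g a ω) μ ∧
      attackMean q x₀ t C (fun a => ∫ ω, g a ω ∂μ)
        = ∫ ω, attackMean q x₀ t C (fun a => g a ω) ∂μ := by
  induction t with
  | zero =>
    intro C g hg
    unfold attackMean
    split_ifs
    · refine ⟨(integrable_finsetSum _ fun j _ => hg _).div_const _, ?_⟩
      rw [integral_div, integral_finsetSum _ fun j _ => hg _]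
    · exact ⟨hg _, rfl⟩
  | succ t ih =>
    intro C g hg
    unfold attackMean
    split_ifs
    · have h1 := fun j (a : Adversary u) => ih (C.erase j)
        (g := fun b => g (.lookup (q j) fun r => if r then a else b)) fun b => hg _
      have h2 := fun j => ih C (g := fun a ω => attackMean q x₀ t (C.erase j)
        fun b => g (.lookup (q j) fun r => if r then a else b) ω) fun a => (h1 j a).1
      refine ⟨(integrable_finsetSum _ fun j _ => (h2 j).1).div_const _, ?_⟩
      rw [integral_div, integral_finsetSum _ fun j _ => (h2 j).1]
      congr 1
      refine Finset.sum_congr rfl fun j _ => ?_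
      rw [← (h2 j).2]
      congr 1
      funext a
      exact (h1 j a).2
    · exact ⟨hg _, rfl⟩

/-- The candidates left after the lookup of the candidate `j`, if `ans` gives the answers. -/
def remaining (ans : Fin m → Bool) (C : Finset (Fin m)) (j : Fin m) : Finset (Fin m) :=
  if ans j = true then C else C.erase j

/-- If `f` depends on a lookup only through the continuation chosen by the answer, the other
continuation is averaged away. -/
theorem attackMean_succ_of_lookup (t : ℕ) {C : Finset (Fin m)} (hC : C.Nonempty)
    {f : Adversary u → ℝ} (ans : Fin m → Bool) (h : Fin m → Adversary u → ℝ)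
    (hf : ∀ j next, f (.lookup (q j) next) = h j (next (ans j))) :
    attackMean q x₀ (t + 1) C f
      = (∑ j ∈ C, attackMean q x₀ t (remaining ans C j) (h j)) / C.card := by
  rw [attackMean, if_pos hC]
  congr 1
  refine Finset.sum_congr rfl fun j _ => ?_
  simp only [hf]
  cases hj : ans j
  · simp [attackMean_const, remaining, hj]
  · simp [attackMean_const, remaining, hj]

/-- The potential doubles only if a candidate of `D` is dropped. -/
theorem sum_half_pow_remaining_le (ans : Fin m → Bool) (C D : Finset (Fin m)) {r : ℕ}
    (hr : (D.filter fun j => ans j = false).card ≤ r) :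
    ∑ j ∈ C, (1 / 2 : ℝ) ^ (remaining ans C j ∩ D).card
      ≤ (C.card + r) * (1 / 2 : ℝ) ^ (C ∩ D).card := by
  have hterm : ∀ j ∈ C, (1 / 2 : ℝ) ^ (remaining ans C j ∩ D).card ≤
      (1 + if j ∈ D ∧ ans j = false then 1 else 0) * (1 / 2 : ℝ) ^ (C ∩ D).card := by
    intro j hj
    unfold remaining
    cases hans : ans j
    · by_cases hD : j ∈ D
      · have h1 : (C.erase j ∩ D).card + 1 = (C ∩ D).card := by
          rw [Finset.erase_inter]
          exact Finset.card_erase_add_one (Finset.mem_inter.2 ⟨hj, hD⟩)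
        rw [← h1, pow_succ]
        simp [hD]
        linarith
      · have h1 : C.erase j ∩ D = C ∩ D := by
          rw [Finset.erase_inter]
          exact Finset.erase_eq_of_notMem fun h => hD (Finset.mem_inter.1 h).2
        simp [hD, h1]
    · simp
  refine (Finset.sum_le_sum hterm).trans ?_
  rw [← Finset.sum_mul]
  gcongr
  rw [Finset.sum_add_distrib]
  simp only [Finset.sum_const, nsmul_eq_mul, mul_one, Finset.sum_boole]
  gcongr
  refine le_trans (Finset.card_le_card fun j hj => ?_) hr
  simp only [Finset.mem_filter] at hj ⊢
  exact hj.2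

theorem sum_card_remaining (ans : Fin m → Bool) (C : Finset (Fin m)) :
    ∑ j ∈ C, ((remaining ans C j).card : ℝ) + ∑ j ∈ C, (if ans j = true then (0 : ℝ) else 1)
      = C.card * C.card := by
  rw [← Finset.sum_add_distrib]
  have : ∀ j ∈ C, ((remaining ans C j).card : ℝ) + (if ans j = true then (0 : ℝ) else 1)
      = C.card := by
    intro j hj
    unfold remaining
    split_ifs
    · simp
    · have := Finset.card_erase_add_one hj
      exact_mod_cast this
  rw [Finset.sum_congr rfl this]
  simp

end LookupAttack

/-! ### The attack against unexcludable queries -/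

section Potential

variable {u m : ℕ} (F : AMQFunctions u) (n : ℕ) (ρ : Coins) (q : Fin m → Fin u) (x₀ : Fin u)

/-- The oracle states that can follow `σ` by lookups of elements `q j`. -/
def lookupsFrom (σ : OracleState u) : Set (OracleState u) :=
  {τ | ∃ l : List (Fin m), τ = l.foldl (fun τ j => F.oracleLookup ρ τ (q j)) σ}

/-- Among the queries in `D`, at most `r` are answered negatively by any single state of
less than `k` bits that can follow `σ`, and no query is a represented element. -/
def Unexcludable (σ : OracleState u) (D : Finset (Fin m)) (r k : ℕ) : Prop :=
  ∀ τ ∈ lookupsFrom F ρ q σ, (∀ j, q j ∉ τ.S) ∧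
    (τ.space < k → (D.filter fun j => F.answer ρ τ (q j) = false).card ≤ r)

variable {F ρ q}

theorem Unexcludable.lookup {σ : OracleState u} {D : Finset (Fin m)} {r k : ℕ}
    (h : Unexcludable F ρ q σ D r k) (j : Fin m) :
    Unexcludable F ρ q (F.oracleLookup ρ σ (q j)) D r k := by
  rintro τ ⟨l, rfl⟩
  exact h _ ⟨j :: l, rfl⟩

theorem Unexcludable.notMem {σ : OracleState u} {D : Finset (Fin m)} {r k : ℕ}
    (h : Unexcludable F ρ q σ D r k) (j : Fin m) : q j ∉ σ.S :=
  (h σ ⟨[], rfl⟩).1 j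

theorem Unexcludable.card_le {σ : OracleState u} {D : Finset (Fin m)} {r k : ℕ}
    (h : Unexcludable F ρ q σ D r k) (hk : σ.space < k) :
    (D.filter fun j => F.answer ρ σ (q j) = false).card ≤ r :=
  (h σ ⟨[], rfl⟩).2 hk

theorem space_le_peakFrom (a : Adversary u) (σ : OracleState u) :
    σ.space ≤ F.peakFrom n ρ a σ := by
  cases a <;> simp [AMQFunctions.peakFrom]

/-- The potential bounds trivially the probability of what happens once `D` is used up. -/
theorem one_le_potential {D C : Finset (Fin m)} {ℓ r : ℕ} (hC : (C ∩ D).card < ℓ) (t : ℕ) :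
    (1 : ℝ) ≤ (1 + r / ℓ : ℝ) ^ t * (2 ^ ℓ * (1 / 2 : ℝ) ^ (C ∩ D).card) := by
  have h1 : (1 : ℝ) ≤ (1 + r / ℓ : ℝ) ^ t := one_le_pow₀ (by
    have : (0 : ℝ) ≤ r / ℓ := by positivity
    linarith)
  have h2 : (1 : ℝ) ≤ 2 ^ ℓ * (1 / 2 : ℝ) ^ (C ∩ D).card := by
    rw [one_div, inv_pow, ← div_eq_mul_inv, one_le_div (by positivity)]
    exact pow_le_pow_right₀ (by norm_num) hC.le
  nlinarith

/-- The expected potential grows by a factor of at most `1 + r / ℓ` per lookup. -/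
theorem sum_potential_remaining_le {σ : OracleState u} {D C : Finset (Fin m)} {r k ℓ : ℕ}
    (h : Unexcludable F ρ q σ D r k) (hk : σ.space < k) (hℓ : 1 ≤ ℓ)
    (hC : ℓ ≤ (C ∩ D).card) (t : ℕ) :
    (∑ j ∈ C, (1 + r / ℓ : ℝ) ^ t * (2 ^ ℓ *
        (1 / 2 : ℝ) ^ (remaining (fun j => F.answer ρ σ (q j)) C j ∩ D).card)) / C.card
      ≤ (1 + r / ℓ : ℝ) ^ (t + 1) * (2 ^ ℓ * (1 / 2 : ℝ) ^ (C ∩ D).card) := by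
  have hCD : (C ∩ D).card ≤ C.card := Finset.card_le_card Finset.inter_subset_left
  have hc : (0 : ℝ) < C.card := by
    have : 0 < C.card := by omega
    exact_mod_cast this
  have hl : (0 : ℝ) < ℓ := by exact_mod_cast hℓ
  have hlc : (ℓ : ℝ) ≤ C.card := by exact_mod_cast hC.trans hCD
  have h0 := sum_half_pow_remaining_le (fun j => F.answer ρ σ (q j)) C D (h.card_le hk)
  rw [← Finset.mul_sum, ← Finset.mul_sum, div_le_iff₀ hc]
  have hb : (C.card : ℝ) + r ≤ (1 + r / ℓ) * C.card := by
    have : (r : ℝ) ≤ r / ℓ * C.card := by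
      rw [div_mul_eq_mul_div, le_div_iff₀ hl]
      gcongr
    linarith
  calc _ ≤ (1 + r / ℓ : ℝ) ^ t * (2 ^ ℓ * ((C.card + r) * (1 / 2 : ℝ) ^ (C ∩ D).card)) := by
        gcongr
    _ ≤ (1 + r / ℓ : ℝ) ^ t * (2 ^ ℓ * (((1 + r / ℓ) * C.card) * (1 / 2 : ℝ) ^ (C ∩ D).card)) := by
        gcongr
    _ = _ := by ring

open Classical in
/-- The sum, over the length of the attack, of the probability that the state remains small
and the output is not a false positive: each negative answer uses up a candidate, and
candidates in `D` are rarely used up. -/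
theorem sum_attackMean_fail_le {D : Finset (Fin m)} {r k ℓ : ℕ} (hℓ : 1 ≤ ℓ) (T : ℕ) :
    ∀ (σ : OracleState u) (C : Finset (Fin m)), Unexcludable F ρ q σ D r k →
    ∑ t ∈ Finset.range T, attackMean q x₀ t C
        (fun a => if F.peakFrom n ρ a σ < k ∧ ¬ F.winsFrom n ρ a σ then 1 else 0)
      ≤ C.card + ∑ t ∈ Finset.range T,
          (1 + r / ℓ : ℝ) ^ t * (2 ^ ℓ * (1 / 2 : ℝ) ^ (C ∩ D).card) := by
  induction T with
  | zero => intro σ C _; simp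
  | succ T ih =>
    intro σ C h
    -- Once fewer than `ℓ` candidates of `D` are left, the potential is at least one.
    by_cases hC : (C ∩ D).card < ℓ
    · refine le_add_of_nonneg_of_le (by positivity) (Finset.sum_le_sum fun t _ => ?_)
      refine le_trans ?_ (one_le_potential hC t)
      calc _ ≤ attackMean q x₀ t C fun _ => 1 :=
            attackMean_mono _ _ _ _ fun a => by split_ifs <;> norm_num
        _ = 1 := attackMean_const _ _ _ _ _
    push Not at hC
    by_cases hk : σ.space < k
    swap
    · refine le_trans (Finset.sum_nonpos fun t _ => ?_) (by positivity)
      calc _ ≤ attackMean q x₀ t C fun _ => 0 := by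
            refine attackMean_mono _ _ _ _ fun a => ?_
            rw [if_neg]
            exact fun h' => hk ((space_le_peakFrom n a σ).trans_lt h'.1)
        _ = 0 := attackMean_const _ _ _ _ _
        _ ≤ 0 := le_rfl
    have hCD : (C ∩ D).card ≤ C.card := Finset.card_le_card Finset.inter_subset_left
    have hCpos : 0 < C.card := by omega
    have hCne : C.Nonempty := Finset.card_pos.1 hCpos
    have hc : (0 : ℝ) < C.card := by exact_mod_cast hCpos
    set ans : Fin m → Bool := fun j => F.answer ρ σ (q j) with hans
    -- The attack of length zero fails with the fraction of negative candidates, by which the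
    -- expected number of candidates decreases in the first step of the longer attacks.
    have h0 : attackMean q x₀ 0 C
        (fun a => if F.peakFrom n ρ a σ < k ∧ ¬ F.winsFrom n ρ a σ then (1 : ℝ) else 0)
        ≤ (∑ j ∈ C, (if ans j = true then (0 : ℝ) else 1)) / C.card := by
      rw [attackMean, if_pos hCne]
      gcongr with j hj
      by_cases hj' : ans j = true
      · have hw : F.winsFrom n ρ (.output (q j)) σ := ⟨hj', h.notMem j⟩
        simp [hw, hj']
      · rw [if_neg hj']; split_ifs <;> norm_num
    have hs : ∀ t, attackMean q x₀ (t + 1) C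
        (fun a => if F.peakFrom n ρ a σ < k ∧ ¬ F.winsFrom n ρ a σ then (1 : ℝ) else 0)
        = (∑ j ∈ C, attackMean q x₀ t (remaining ans C j) (fun a =>
            if F.peakFrom n ρ a (F.oracleLookup ρ σ (q j)) < k ∧
              ¬ F.winsFrom n ρ a (F.oracleLookup ρ σ (q j)) then 1 else 0)) / C.card := by
      intro t
      refine attackMean_succ_of_lookup q x₀ t hCne ans _ fun j next => ?_
      simp [AMQFunctions.peakFrom, AMQFunctions.winsFrom, hk, hans]
    rw [Finset.sum_range_succ']
    simp only [hs]
    rw [← Finset.sum_div, Finset.sum_comm]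
    have h1 : ∀ j ∈ C, ∑ t ∈ Finset.range T, attackMean q x₀ t (remaining ans C j) (fun a =>
            if F.peakFrom n ρ a (F.oracleLookup ρ σ (q j)) < k ∧
              ¬ F.winsFrom n ρ a (F.oracleLookup ρ σ (q j)) then 1 else 0)
        ≤ (remaining ans C j).card + ∑ t ∈ Finset.range T,
          (1 + r / ℓ : ℝ) ^ t * (2 ^ ℓ * (1 / 2 : ℝ) ^ (remaining ans C j ∩ D).card) :=
      fun j _ => ih _ _ (h.lookup j)
    have h2 := Finset.sum_le_sum h1
    rw [Finset.sum_add_distrib] at h2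
    have h3 : (∑ j ∈ C, ∑ t ∈ Finset.range T,
          (1 + r / ℓ : ℝ) ^ t * (2 ^ ℓ * (1 / 2 : ℝ) ^ (remaining ans C j ∩ D).card)) / C.card
        ≤ ∑ t ∈ Finset.range T,
          (1 + r / ℓ : ℝ) ^ (t + 1) * (2 ^ ℓ * (1 / 2 : ℝ) ^ (C ∩ D).card) := by
      rw [Finset.sum_comm, Finset.sum_div]
      exact Finset.sum_le_sum fun t _ => sum_potential_remaining_le h hk hℓ hC t
    have h4 := sum_card_remaining ans C
    have h5 : (∑ j ∈ C, ((remaining ans C j).card : ℝ)) / C.card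
        + (∑ j ∈ C, (if ans j = true then (0 : ℝ) else 1)) / C.card = C.card := by
      rw [← add_div, h4, mul_div_cancel_right₀ _ hc.ne']
    rw [Finset.sum_range_succ' (fun t => (1 + r / ℓ : ℝ) ^ t *
      (2 ^ ℓ * (1 / 2 : ℝ) ^ (C ∩ D).card))]
    have h6 : (0 : ℝ) ≤ (1 + r / ℓ : ℝ) ^ 0 * (2 ^ ℓ * (1 / 2 : ℝ) ^ (C ∩ D).card) := by positivity
    have h7 := div_le_div_of_nonneg_right h2 hc.le
    rw [add_div] at h7
    linarith

open Classical in
/-- While the state remains small and `D` is not used up, each of the `t` lookups is answered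
positively unless it uses up a candidate. -/
theorem attackMean_few_positive_le {D : Finset (Fin m)} {r k ℓ : ℕ} (hℓ : 1 ≤ ℓ) (t : ℕ) :
    ∀ (σ : OracleState u) (C : Finset (Fin m)), Unexcludable F ρ q σ D r k →
    attackMean q x₀ t C
        (fun a => if F.peakFrom n ρ a σ < k ∧
          (F.answersFrom n ρ a σ).count true + C.card < t then 1 else 0)
      ≤ (1 + r / ℓ : ℝ) ^ t * (2 ^ ℓ * (1 / 2 : ℝ) ^ (C ∩ D).card) := by
  induction t with
  | zero =>
    intro σ C _
    simp only [Nat.not_lt_zero, and_false, if_false, attackMean_const]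
    positivity
  | succ t ih =>
    intro σ C h
    by_cases hC : (C ∩ D).card < ℓ
    · refine le_trans ?_ (one_le_potential hC (t + 1))
      calc _ ≤ attackMean q x₀ (t + 1) C fun _ => 1 :=
            attackMean_mono _ _ _ _ fun a => by split_ifs <;> norm_num
        _ = 1 := attackMean_const _ _ _ _ _
    push Not at hC
    by_cases hk : σ.space < k
    swap
    · calc _ ≤ attackMean q x₀ (t + 1) C fun _ => 0 := by
            refine attackMean_mono _ _ _ _ fun a => ?_
            rw [if_neg]
            exact fun h' => hk ((space_le_peakFrom n a σ).trans_lt h'.1)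
        _ = 0 := attackMean_const _ _ _ _ _
        _ ≤ _ := by positivity
    have hCD : (C ∩ D).card ≤ C.card := Finset.card_le_card Finset.inter_subset_left
    have hCpos : 0 < C.card := by omega
    have hCne : C.Nonempty := Finset.card_pos.1 hCpos
    set ans : Fin m → Bool := fun j => F.answer ρ σ (q j) with hans
    rw [attackMean_succ_of_lookup q x₀ t hCne ans (fun j a =>
      if F.peakFrom n ρ a (F.oracleLookup ρ σ (q j)) < k ∧
        ((F.answersFrom n ρ a (F.oracleLookup ρ σ (q j))).count true
          + if ans j = true then 1 else 0) + C.card < t + 1 then 1 else 0)]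
    · refine le_trans ?_ (sum_potential_remaining_le h hk hℓ hC t)
      gcongr with j hj
      refine le_trans (le_of_eq ?_) (ih (F.oracleLookup ρ σ (q j)) (remaining ans C j) (h.lookup j))
      congr 1
      funext a
      congr 1
      rw [eq_iff_iff]
      refine and_congr_right fun _ => ?_
      unfold remaining
      cases hj' : ans j
      · have := Finset.card_erase_add_one hj
        simp; omega
      · simp; omega
    · intro j next
      simp only [AMQFunctions.peakFrom, AMQFunctions.answersFrom, hans, List.count_cons, hk,
        max_lt_iff, true_and]
      simp

end Potential

/-! ### Measurability of the course of the game -/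

section Measurability

/-- All fibres of a function of the random string are events. -/
def MeasurableFibres {β : Type*} (f : Coins → β) : Prop :=
  ∀ t, MeasurableSet {ρ | f ρ = t}

variable {β γ : Type*}

theorem measurableFibres_const (b : β) : MeasurableFibres fun _ => b :=
  fun _ => MeasurableSet.const _

theorem MeasurableFibres.bind [Countable β] {f : Coins → β} {g : Coins → β → γ}
    (hf : MeasurableFibres f) (hg : ∀ b, MeasurableFibres fun ρ => g ρ b) :
    MeasurableFibres fun ρ => g ρ (f ρ) := by
  intro t
  have : {ρ | g ρ (f ρ) = t} = ⋃ b, {ρ | f ρ = b} ∩ {ρ | g ρ b = t} := by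
    ext ρ; simp
  rw [this]
  exact MeasurableSet.iUnion fun b => (hf b).inter (hg b t)

theorem MeasurableFibres.comp [Countable β] {f : Coins → β} (hf : MeasurableFibres f)
    (g : β → γ) : MeasurableFibres fun ρ => g (f ρ) :=
  hf.bind (g := fun _ => g) fun b => measurableFibres_const (g b)

theorem MeasurableFibres.prodMk {f : Coins → β} {g : Coins → γ}
    (hf : MeasurableFibres f) (hg : MeasurableFibres g) :
    MeasurableFibres fun ρ => (f ρ, g ρ) := by
  rintro ⟨b, c⟩
  have : {ρ | (f ρ, g ρ) = (b, c)} = {ρ | f ρ = b} ∩ {ρ | g ρ = c} := by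
    ext ρ; simp
  rw [this]
  exact (hf b).inter (hg c)

theorem MeasurableFibres.measurableSet [Countable β] {f : Coins → β} (hf : MeasurableFibres f)
    (p : β → Prop) : MeasurableSet {ρ | p (f ρ)} := by
  have : {ρ | p (f ρ)} = ⋃ b ∈ {b | p b}, {ρ | f ρ = b} := by
    ext ρ; simp
  rw [this]
  exact MeasurableSet.biUnion (Set.to_countable _) fun b _ => hf b

variable {u : ℕ} (F : AMQFunctions u) (n : ℕ)

instance : Countable (OracleState u) :=
  Function.Injective.countable (f := fun σ : OracleState u => (σ.S, σ.state)) (by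
    rintro ⟨S, s⟩ ⟨S', s'⟩ h
    simpa using h)

theorem measurableFibres_start : MeasurableFibres fun ρ => F.start ρ :=
  MeasurableFibres.comp (f := F.build) F.measurable_build
    fun s => (⟨∅, s⟩ : OracleState u)

theorem measurableFibres_oracleInsert (σ : OracleState u) (x : Fin u) :
    MeasurableFibres fun ρ => F.oracleInsert n ρ σ x := by
  unfold AMQFunctions.oracleInsert
  split_ifs
  · exact MeasurableFibres.comp (F.measurable_insert σ.state x)
      fun s => (⟨Insert.insert x σ.S, s⟩ : OracleState u)
  · exact measurableFibres_const _

theorem measurableFibres_oracleDelete (σ : OracleState u) (x : Fin u) :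
    MeasurableFibres fun ρ => F.oracleDelete ρ σ x := by
  unfold AMQFunctions.oracleDelete
  split_ifs
  · exact MeasurableFibres.comp (F.measurable_delete σ.state x)
      fun s => (⟨σ.S.erase x, s⟩ : OracleState u)
  · exact measurableFibres_const _

theorem measurableFibres_answer (σ : OracleState u) (x : Fin u) :
    MeasurableFibres fun ρ => F.answer ρ σ x :=
  MeasurableFibres.comp (F.measurable_lookup σ.state.1 x) Prod.snd

theorem measurableFibres_oracleLookup (σ : OracleState u) (x : Fin u) :
    MeasurableFibres fun ρ => F.oracleLookup ρ σ x := by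
  refine MeasurableFibres.bind (f := fun ρ => F.lookup σ.state.1 x ρ)
    (g := fun ρ p => if p.2 = true ∧ x ∉ σ.S then
      (⟨σ.S, F.update (p.1, σ.state.2) x ρ⟩ : OracleState u) else ⟨σ.S, (p.1, σ.state.2)⟩)
    (F.measurable_lookup σ.state.1 x) fun p => ?_
  split_ifs
  · exact MeasurableFibres.comp (F.measurable_update (p.1, σ.state.2) x)
      fun s => (⟨σ.S, s⟩ : OracleState u)
  · exact measurableFibres_const _

theorem measurableFibres_winsFrom (a : Adversary u) : ∀ σ : OracleState u,
    MeasurableFibres fun ρ => F.winsFrom n ρ a σ := by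
  induction a with
  | output x =>
    intro σ
    exact (measurableFibres_answer F σ x).comp fun b => b = true ∧ x ∉ σ.S
  | insert x next ih =>
    exact fun σ => (measurableFibres_oracleInsert F n σ x).bind ih
  | delete x next ih =>
    exact fun σ => (measurableFibres_oracleDelete F σ x).bind ih
  | lookup x next ih =>
    exact fun σ => ((measurableFibres_answer F σ x).prodMk
      (measurableFibres_oracleLookup F σ x)).bind
        (g := fun ρ (p : Bool × OracleState u) => F.winsFrom n ρ (next p.1) p.2) fun p => ih p.1 p.2

theorem measurableFibres_peakFrom (a : Adversary u) : ∀ σ : OracleState u,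
    MeasurableFibres fun ρ => F.peakFrom n ρ a σ := by
  induction a with
  | output x => exact fun σ => measurableFibres_const _
  | insert x next ih =>
    exact fun σ => ((measurableFibres_oracleInsert F n σ x).bind ih).comp (max σ.space)
  | delete x next ih =>
    exact fun σ => ((measurableFibres_oracleDelete F σ x).bind ih).comp (max σ.space)
  | lookup x next ih =>
    exact fun σ => (((measurableFibres_answer F σ x).prodMk
      (measurableFibres_oracleLookup F σ x)).bind
        (g := fun ρ (p : Bool × OracleState u) => F.peakFrom n ρ (next p.1) p.2) fun p => ih p.1 p.2).comp (max σ.space)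

theorem measurableFibres_answersFrom (a : Adversary u) : ∀ σ : OracleState u,
    MeasurableFibres fun ρ => F.answersFrom n ρ a σ := by
  induction a with
  | output x => exact fun σ => measurableFibres_const _
  | insert x next ih =>
    exact fun σ => (measurableFibres_oracleInsert F n σ x).bind ih
  | delete x next ih =>
    exact fun σ => (measurableFibres_oracleDelete F σ x).bind ih
  | lookup x next ih =>
    exact fun σ => ((measurableFibres_answer F σ x).prodMk
      (measurableFibres_oracleLookup F σ x)).bind
        (g := fun ρ (p : Bool × OracleState u) => p.1 :: F.answersFrom n ρ (next p.1) p.2)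
        fun p => (ih p.1 p.2).comp (List.cons p.1)

end Measurability

/-! ### Initial insertions -/

section Insertions

variable {u : ℕ} (F : AMQFunctions u) (n : ℕ)

/-- The oracle state after the insertion of the elements of a list, right after set-up. -/
def afterInsertions (ρ : Coins) (l : List (Fin u)) : OracleState u :=
  l.foldl (F.oracleInsert n ρ) (F.start ρ)

theorem winsFrom_foldr_insert (ρ : Coins) (a : Adversary u) (l : List (Fin u)) :
    ∀ σ, F.winsFrom n ρ (l.foldr Adversary.insert a) σ
      = F.winsFrom n ρ a (l.foldl (F.oracleInsert n ρ) σ) := by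
  induction l with
  | nil => exact fun _ => rfl
  | cons x l ih => exact fun σ => ih _

theorem answersFrom_foldr_insert (ρ : Coins) (a : Adversary u) (l : List (Fin u)) :
    ∀ σ, F.answersFrom n ρ (l.foldr Adversary.insert a) σ
      = F.answersFrom n ρ a (l.foldl (F.oracleInsert n ρ) σ) := by
  induction l with
  | nil => exact fun _ => rfl
  | cons x l ih => exact fun σ => ih _

theorem peakFrom_le_peakFrom_foldr_insert (ρ : Coins) (a : Adversary u) (l : List (Fin u)) :
    ∀ σ, F.peakFrom n ρ a (l.foldl (F.oracleInsert n ρ) σ)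
      ≤ F.peakFrom n ρ (l.foldr Adversary.insert a) σ := by
  induction l with
  | nil => exact fun _ => le_rfl
  | cons x l ih => exact fun σ => (ih _).trans (le_max_right _ _)

theorem measurableFibres_afterInsertions (l : List (Fin u)) :
    MeasurableFibres fun ρ => afterInsertions F n ρ l := by
  induction l using List.reverseRecOn with
  | nil => exact measurableFibres_start F
  | append_singleton l x ih =>
    simp only [afterInsertions, List.foldl_append, List.foldl_cons, List.foldl_nil]
    exact ih.bind (g := fun ρ τ => F.oracleInsert n ρ τ x)
      fun τ => measurableFibres_oracleInsert F n τ x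

theorem reachable_afterInsertions (ρ : Coins) (l : List (Fin u)) :
    F.Reachable n ρ (afterInsertions F n ρ l) := by
  induction l using List.reverseRecOn with
  | nil => exact .start
  | append_singleton l x ih =>
    simp only [afterInsertions, List.foldl_append, List.foldl_cons, List.foldl_nil]
    exact .insert _ x ih

theorem afterInsertions_S (ρ : Coins) (l : List (Fin u)) (hl : l.length ≤ n) :
    (afterInsertions F n ρ l).S = l.toFinset := by
  induction l using List.reverseRecOn with
  | nil => rfl
  | append_singleton l x ih =>
    simp only [List.length_append, List.length_singleton] at hl
    have ih' := ih (by omega)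
    have hc : (afterInsertions F n ρ l).S.card < n := by
      rw [ih']; exact (List.toFinset_card_le l).trans_lt (by omega)
    have : afterInsertions F n ρ (l ++ [x])
        = F.oracleInsert n ρ (afterInsertions F n ρ l) x := by
      simp [afterInsertions]
    rw [this, AMQFunctions.oracleInsert]
    split_ifs with h
    · ext y; simp [ih']
    -- The list is too short to overload the filter, so only a repetition is ignored.
    · have hx : x ∈ l.toFinset := by
        rw [← ih']; by_contra hx; exact h ⟨hc, hx⟩
      rw [ih']; ext y
      simp only [List.toFinset_append, Finset.mem_union, List.mem_toFinset]
      constructor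
      · exact Or.inl
      · rintro (hy | hy)
        · exact hy
        · simp at hy; subst hy; simpa using hx

end Insertions

/-! ### Concentration of the number of positive answers -/

section Concentration

variable {u : ℕ} (F : AMQFunctions u) (n : ℕ)

instance : IsProbabilityMeasure coinMeasure := by
  unfold coinMeasure; infer_instance

/-- On the event `A`, after which the oracle is in state `st`, the rate of false positives is
at most `ε` regardless of what is seen afterwards. -/
def RateGivenHistoryFrom (ε : ℝ) (A : Set Coins) (st : Coins → OracleState u) : Prop :=
  ∀ (a : Adversary u) (h : List Bool),
    coinMeasure.real {ρ | ρ ∈ A ∧ F.winsFrom n ρ a (st ρ) ∧ F.answersFrom n ρ a (st ρ) = h} ≤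
      ε * coinMeasure.real {ρ | ρ ∈ A ∧ F.answersFrom n ρ a (st ρ) = h}

variable {F n}

theorem RateGivenHistoryFrom.lookup {ε : ℝ} {A : Set Coins} {st : Coins → OracleState u}
    (h : RateGivenHistoryFrom F n ε A st) (x : Fin u) (b : Bool) :
    RateGivenHistoryFrom F n ε (A ∩ {ρ | F.answer ρ (st ρ) x = b})
      fun ρ => F.oracleLookup ρ (st ρ) x := by
  intro a l
  have := h (.lookup x fun _ => a) (b :: l)
  simp only [AMQFunctions.winsFrom, AMQFunctions.answersFrom, List.cons.injEq] at this
  convert this using 3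
  · ext ρ; simp only [Set.mem_inter_iff, Set.mem_ofPred_eq]; tauto
  · congr 1
    ext ρ; simp only [Set.mem_inter_iff, Set.mem_ofPred_eq]; tauto

/-- If no history makes a positive answer more likely than `ε`, then the probability of `K`
positive answers among `t` lookups is at most `(1 + ε) ^ t / 2 ^ K`: the expectation of
`2 ^ (number of positive answers)` grows by a factor of at most `1 + ε` per lookup. -/
theorem RateGivenHistoryFrom.measureReal_count_le {m : ℕ} {q : Fin m → Fin u} {ε : ℝ}
    (hε : 0 ≤ ε) (t : ℕ) : ∀ (a : Adversary u) (K : ℕ) (A : Set Coins) (st : Coins → OracleState u),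
    MeasurableSet A → MeasurableFibres st → RateGivenHistoryFrom F n ε A st →
    (∀ ρ j, q j ∉ (st ρ).S) → OnlyLookups q t a →
    2 ^ K * coinMeasure.real (A ∩ {ρ | K ≤ (F.answersFrom n ρ a (st ρ)).count true})
      ≤ (1 + ε) ^ t * coinMeasure.real A := by
  have hout : ∀ (t : ℕ) (x : Fin u) (K : ℕ) (A : Set Coins) (st : Coins → OracleState u),
      2 ^ K * coinMeasure.real (A ∩ {ρ | K ≤ (F.answersFrom n ρ (.output x) (st ρ)).count true})
        ≤ (1 + ε) ^ t * coinMeasure.real A := by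
    intro t x K A st
    have h1 : 1 ≤ (1 + ε) ^ t := one_le_pow₀ (by linarith)
    have h0 : 0 ≤ coinMeasure.real A := measureReal_nonneg
    simp only [AMQFunctions.answersFrom, List.count_nil, Nat.le_zero]
    rcases Nat.eq_zero_or_pos K with rfl | hK
    · simp; nlinarith
    · have : {ρ : Coins | K = 0} = ∅ := by ext; simp; omega
      rw [this]; simp; positivity
  induction t with
  | zero =>
    intro a K A st hA hst hr hq ha
    cases a with
    | output x => exact hout 0 x K A st
    | insert | delete | lookup => simp [OnlyLookups] at ha
  | succ t ih =>
    intro a K A st hA hst hr hq ha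
    cases a with
    | output x => exact hout _ x K A st
    | insert | delete => simp [OnlyLookups] at ha
    | lookup x next =>
      simp only [OnlyLookups] at ha
      obtain ⟨⟨j, rfl⟩, hnext⟩ := ha
      set E : Bool → Set Coins := fun b => {ρ | F.answer ρ (st ρ) (q j) = b} with hE
      have hEm : ∀ b, MeasurableSet (E b) := fun b =>
        hst.bind (g := fun ρ τ => F.answer ρ τ (q j))
          (fun τ => measurableFibres_answer F τ (q j)) b
      set st' : Coins → OracleState u := fun ρ => F.oracleLookup ρ (st ρ) (q j) with hst'
      have hst'm : MeasurableFibres st' := hst.bind (g := fun ρ τ => F.oracleLookup ρ τ (q j))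
          fun τ => measurableFibres_oracleLookup F τ (q j)
      have hq' : ∀ ρ i, q i ∉ (st' ρ).S := by
        intro ρ i
        have : (st' ρ).S = (st ρ).S := by
          simp only [hst', AMQFunctions.oracleLookup]; split_ifs <;> rfl
        rw [this]; exact hq ρ i
      have hi := fun b K => ih (next b) K (A ∩ E b) st' (hA.inter (hEm b)) hst'm
        (hr.lookup (q j) b) hq' (hnext b)
      have h1 := hi true (K - 1)
      have h0 := hi false K
      -- Split by the answer; for `K = 0` the truncated `K - 1` only enlarges the event.
      have hsub : A ∩ {ρ | K ≤ (F.answersFrom n ρ (.lookup (q j) next) (st ρ)).count true} ⊆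
          (A ∩ E true ∩ {ρ | K - 1 ≤ (F.answersFrom n ρ (next true) (st' ρ)).count true}) ∪
          (A ∩ E false ∩ {ρ | K ≤ (F.answersFrom n ρ (next false) (st' ρ)).count true}) := by
        rintro ρ ⟨hρA, hρ⟩
        simp only [Set.mem_ofPred_eq, AMQFunctions.answersFrom] at hρ
        cases hb : F.answer ρ (st ρ) (q j)
        · refine Or.inr ⟨⟨hρA, hb⟩, ?_⟩
          simpa [hb] using hρ
        · refine Or.inl ⟨⟨hρA, hb⟩, ?_⟩
          simp only [hb, List.count_cons_self] at hρ
          simp only [Set.mem_ofPred_eq, hst']; omega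
      have hle := (measureReal_mono (μ := coinMeasure) hsub).trans (measureReal_union_le _ _)
      have hsum : coinMeasure.real (A ∩ E true) + coinMeasure.real (A ∩ E false)
          = coinMeasure.real A := by
        have hd : E false = (E true)ᶜ := by ext ρ; simp [hE]
        have := measureReal_inter_add_sdiff (μ := coinMeasure) (s := A) (hEm true)
        rw [hd]
        rwa [Set.sdiff_eq] at this
      -- The rate, applied to the adversary that outputs `q j` at once.
      have hrate : coinMeasure.real (A ∩ E true) ≤ ε * coinMeasure.real A := by
        have := hr (.output (q j)) []
        simpa [AMQFunctions.winsFrom, AMQFunctions.answersFrom, hq, hE, Set.inter_def] using this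
      set y1 := coinMeasure.real (A ∩ E true ∩
        {ρ | K - 1 ≤ (F.answersFrom n ρ (next true) (st' ρ)).count true})
      set y0 := coinMeasure.real (A ∩ E false ∩
        {ρ | K ≤ (F.answersFrom n ρ (next false) (st' ρ)).count true})
      have hy1 : 0 ≤ y1 := measureReal_nonneg
      have hK : (2 : ℝ) ^ K ≤ 2 * 2 ^ (K - 1) := by
        rw [← pow_succ']
        exact pow_le_pow_right₀ (by norm_num) (by omega)
      have hp : 0 ≤ (1 + ε) ^ t := by positivity
      calc _ ≤ 2 ^ K * (y1 + y0) := by gcongr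
        _ = 2 ^ K * y1 + 2 ^ K * y0 := by ring
        _ ≤ 2 * 2 ^ (K - 1) * y1 + 2 ^ K * y0 := by gcongr
        _ ≤ (1 + ε) ^ t * (2 * coinMeasure.real (A ∩ E true) + coinMeasure.real (A ∩ E false)) := by
            linarith
        _ ≤ (1 + ε) ^ t * ((1 + ε) * coinMeasure.real A) := by
            gcongr; linarith
        _ = _ := by ring

end Concentration

/-! ### The number of small states -/

section SmallStates

open Classical in
theorem exists_card_lists_lt (k : ℕ) :
    ∃ s : Finset (List Bool), (∀ l : List Bool, l.length < k → l ∈ s) ∧ s.card ≤ 2 ^ k := by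
  induction k with
  | zero => exact ⟨∅, by simp, by simp⟩
  | succ k ih =>
    obtain ⟨s, hs, hc⟩ := ih
    refine ⟨s ∪ Finset.univ.image fun f : Fin k → Bool => List.ofFn f, fun l hl => ?_, ?_⟩
    · rcases Nat.lt_succ_iff_lt_or_eq.1 hl with h | h
      · exact Finset.mem_union_left _ (hs l h)
      · subst h
        exact Finset.mem_union_right _ (Finset.mem_image.2 ⟨l.get, Finset.mem_univ _,
          List.ofFn_get l⟩)
    · refine (Finset.card_union_le _ _).trans ?_
      have : (Finset.univ.image fun f : Fin k → Bool => List.ofFn f).card ≤ 2 ^ k :=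
        Finset.card_image_le.trans (by simp)
      rw [pow_succ]; omega

theorem exists_smallStates (k : ℕ) :
    ∃ s : Finset BitState, (∀ z : BitState, z ∈ s ↔ z.1.length + z.2.length < k) ∧
      (s.card : ℝ) ≤ 4 ^ k := by
  classical
  obtain ⟨s, hs, hc⟩ := exists_card_lists_lt k
  refine ⟨(s ×ˢ s).filter fun z => z.1.length + z.2.length < k, fun z => ?_, ?_⟩
  · simp only [Finset.mem_filter, Finset.mem_product, and_iff_right_iff_imp]
    intro h
    exact ⟨hs _ (by omega), hs _ (by omega)⟩
  · have : ((s ×ˢ s).filter fun z => z.1.length + z.2.length < k).card ≤ 4 ^ k := by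
      refine (Finset.card_filter_le _ _).trans ?_
      rw [Finset.card_product, show (4 : ℕ) = 2 * 2 from rfl, mul_pow]
      exact Nat.mul_le_mul hc hc
    exact_mod_cast this

end SmallStates

/-! ### Random insertions followed by the random attack -/

section RandomAttack

variable {u n m : ℕ}

theorem foldl_oracleLookup_S (F : AMQFunctions u) (ρ : Coins) (Q : Fin m → Fin u)
    (l : List (Fin m)) : ∀ σ : OracleState u,
    (l.foldl (fun τ j => F.oracleLookup ρ τ (Q j)) σ).S = σ.S := by
  induction l with
  | nil => exact fun _ => rfl
  | cons j l ih =>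
    intro σ
    rw [List.foldl_cons, ih, AMQFunctions.oracleLookup]
    split_ifs <;> rfl

/-- Lookups of elements outside the represented set act on the state of the filter in a way that
does not depend on the represented set: every positive answer is reported to be false. -/
theorem foldl_oracleLookup_state (F : AMQFunctions u) (ρ : Coins) (Q : Fin m → Fin u)
    (l : List (Fin m)) : ∀ σ σ' : OracleState u, σ.state = σ'.state → (∀ j, Q j ∉ σ.S) →
    (∀ j, Q j ∉ σ'.S) → (l.foldl (fun τ j => F.oracleLookup ρ τ (Q j)) σ).state
      = (l.foldl (fun τ j => F.oracleLookup ρ τ (Q j)) σ').state := by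
  induction l with
  | nil => exact fun _ _ h _ _ => h
  | cons j l ih =>
    intro σ σ' h hσ hσ'
    rw [List.foldl_cons, List.foldl_cons]
    refine ih _ _ ?_ ?_ ?_
    · simp only [AMQFunctions.oracleLookup, AMQFunctions.answer, h, hσ j, hσ' j, not_false_eq_true,
        and_true]
      split_ifs <;> rfl
    · intro i
      have := foldl_oracleLookup_S F ρ Q [j] σ
      simp only [List.foldl_cons, List.foldl_nil] at this
      rw [this]; exact hσ i
    · intro i
      have := foldl_oracleLookup_S F ρ Q [j] σ'
      simp only [List.foldl_cons, List.foldl_nil] at this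
      rw [this]; exact hσ' i

theorem reachable_foldl_oracleLookup (F : AMQFunctions u) (ρ : Coins) (Q : Fin m → Fin u)
    (l : List (Fin m)) : ∀ σ : OracleState u, F.Reachable n ρ σ →
    F.Reachable n ρ (l.foldl (fun τ j => F.oracleLookup ρ τ (Q j)) σ) := by
  induction l with
  | nil => exact fun _ h => h
  | cons j l ih => exact fun σ h => ih _ (.lookup σ (Q j) h)

theorem mem_afterInsertions_ofFn (F : AMQFunctions u) (ρ : Coins) (s : Fin n → Fin u) (x : Fin u) :
    x ∈ (afterInsertions F n ρ (List.ofFn s)).S ↔ ∃ i, s i = x := by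
  rw [afterInsertions_S F n ρ _ (by simp)]
  simp [List.mem_ofFn]

open Classical in
/-- For each value of the random string, most pairs of insertions and queries that lead to a small
state leave many of the queries unexcludable. -/
theorem card_not_unexcludable_le (A : AMQ u n) (ρ : Coins) {d r k : ℕ} {η κ ξ : ℝ}
    (hη : 0 < η) (hκ : 0 ≤ κ) (hξ : 0 < ξ) (hn : 0 < n) (hm : 1 ≤ m) (hu : 0 < u)
    (hd : d ≤ m) (hr : r ≤ m)
    (h1 : 2 * 2 ^ n * κ ^ (n / 2) * 4 ^ k < η)
    (h2 : m.choose (m - d) * (1 - κ) ^ (m - d) ≤ η)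
    (h3 : 4 ^ k * (m.choose r * ξ ^ r) ≤ η)
    (h4 : 4 * (n * m : ℝ) ≤ η * (ξ * u))
    (h5 : (n * m : ℝ) ≤ η * u) :
    ((Finset.univ.filter fun sQ : (Fin n → Fin u) × (Fin m → Fin u) =>
        (afterInsertions A.toAMQFunctions n ρ (List.ofFn sQ.1)).space < k ∧
        ¬ ∃ D : Finset (Fin m), d ≤ D.card ∧ Unexcludable A.toAMQFunctions ρ sQ.2
          (afterInsertions A.toAMQFunctions n ρ (List.ofFn sQ.1)) D r k).card : ℝ)
      ≤ 5 * η * ((u : ℝ) ^ n * (u : ℝ) ^ m) := by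
  obtain ⟨states, hmem, hcard⟩ := exists_smallStates k
  set F := A.toAMQFunctions
  set σ : (Fin n → Fin u) → OracleState u := fun s => afterInsertions F n ρ (List.ofFn s) with hσ
  have key : ∀ s (Q : Fin m → Fin u) (l : List (Fin m)), (∀ i j, s i ≠ Q j) →
      (l.foldl (fun τ j => F.oracleLookup ρ τ (Q j)) (σ s)).state
      = (l.foldl (fun τ j => F.oracleLookup ρ τ (Q j)) ⟨∅, (σ s).state⟩).state := by
    intro s Q l h
    refine foldl_oracleLookup_state F ρ Q l _ _ rfl (fun j => ?_) (by simp)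
    rw [mem_afterInsertions_ofFn]
    rintro ⟨i, hi⟩
    exact h i j hi
  have main := card_excludable_le (U := Fin u) (n := n) (m := m) (d := d) (r := r)
    (fun s => (σ s).state) states
    (fun z => Finset.univ.filter fun x => (F.lookup z.1 x ρ).2 = true)
    (fun y Q => {z | ∃ l : List (Fin m),
      z = (l.foldl (fun τ j => F.oracleLookup ρ τ (Q j)) ⟨∅, y⟩).state})
    (N := 4 ^ k) (η := η) (κ := κ) (ξ := ξ)
    (by
      rintro s Q z hdis ⟨l, rfl⟩ i
      rw [← key s Q l hdis]
      simp only [Finset.mem_filter, Finset.mem_univ, true_and]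
      refine A.no_false_negatives ρ _ (reachable_foldl_oracleLookup F ρ Q l _
        (reachable_afterInsertions F n ρ _)) (s i) ?_
      rw [foldl_oracleLookup_S, mem_afterInsertions_ofFn]
      exact ⟨i, rfl⟩)
    hcard (by positivity) hη hκ hξ hn hm (by simpa using hu) hd hr h1 h2 h3
    (by simpa using h4) (by simpa using h5)
    (fun s Q => ∃ D : Finset (Fin m), d ≤ D.card ∧ Unexcludable F ρ Q (σ s) D r k)
    (by
      rintro s Q hdis ⟨D, hD, h⟩
      refine ⟨D, hD, ?_⟩
      rintro τ ⟨l, rfl⟩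
      refine ⟨fun j => ?_, fun hk => ?_⟩
      · rw [foldl_oracleLookup_S, mem_afterInsertions_ofFn]
        rintro ⟨i, hi⟩
        exact hdis i j hi
      · have := h _ ⟨l, key s Q l hdis⟩ ((hmem _).2 hk)
        convert this using 3
        simp [AMQFunctions.answer])
  simp only [hmem, Fintype.card_fin] at main
  exact main

/-- If the values of `g` for random attacks are at most `β` on average for each random string, then
some attack has a value of at most `β` in expectation over the random string. -/
theorem exists_integral_le_of_sum_attackMean_le {ι : Type*} [Fintype ι] [Nonempty ι]
    (q : ι → Fin m → Fin u) (x₀ : Fin u) (t : ι → ℕ) (C : Finset (Fin m))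
    (g : ι → Adversary u → Coins → ℝ) (hg : ∀ i a, Integrable (g i a) coinMeasure) {β : ℝ}
    (hβ : ∀ ρ, ∑ i, attackMean (q i) x₀ (t i) C (fun a => g i a ρ) ≤ Fintype.card ι * β) :
    ∃ i a, OnlyLookups (q i) (t i) a ∧ ∫ ρ, g i a ρ ∂coinMeasure ≤ β := by
  have h := fun i => attackMean_integral (q i) x₀ coinMeasure (t i) C (hg i)
  have hsum : ∑ i, attackMean (q i) x₀ (t i) C (fun a => ∫ ρ, g i a ρ ∂coinMeasure)
      ≤ ∑ _i : ι, β := by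
    rw [Finset.sum_congr rfl fun i _ => (h i).2, ← integral_finsetSum _ fun i _ => (h i).1]
    calc _ ≤ ∫ _, (Fintype.card ι * β : ℝ) ∂coinMeasure :=
          integral_mono (integrable_finsetSum _ fun i _ => (h i).1) (integrable_const _) hβ
      _ = _ := by simp
  obtain ⟨i, -, hi⟩ := Finset.exists_le_of_sum_le Finset.univ_nonempty hsum
  obtain ⟨a, ha, hfa⟩ := exists_onlyLookups_le_attackMean (q i) x₀ (t i) C
    fun a => ∫ ρ, g i a ρ ∂coinMeasure
  exact ⟨i, a, ha, hfa.trans hi⟩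

theorem sum_le_card_mul_of_exceptional {ι : Type*} [Fintype ι] (bad : ι → Prop)
    [DecidablePred bad] (f : ι → ℝ)
    {X Λ : ℝ} (hΛ : 0 ≤ Λ) (h1 : ∀ i, f i ≤ X) (h2 : ∀ i, ¬ bad i → f i ≤ Λ) :
    ∑ i, f i ≤ (Finset.univ.filter bad).card * X + Fintype.card ι * Λ := by
  calc ∑ i, f i ≤ ∑ i, ((if bad i then X else 0) + Λ) := by
        refine Finset.sum_le_sum fun i _ => ?_
        split_ifs with h
        · linarith [h1 i]
        · linarith [h2 i h]
    _ = _ := by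
        rw [Finset.sum_add_distrib, ← Finset.sum_filter]
        simp [mul_comm]

/-- The potential with which an attack starts, if `D` is twice as large as needed. -/
theorem potential_le_of_card {D : Finset (Fin m)} {r ℓ T t : ℕ} {Λ : ℝ} (hD : 2 * ℓ ≤ D.card)
    (ht : t ≤ T) (hΛ : (1 + r / ℓ : ℝ) ^ T * (1 / 2) ^ ℓ ≤ Λ) :
    (1 + r / ℓ : ℝ) ^ t * (2 ^ ℓ * (1 / 2 : ℝ) ^ (Finset.univ ∩ D).card) ≤ Λ := by
  refine le_trans ?_ hΛ
  rw [Finset.univ_inter]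
  have h0 : (0 : ℝ) ≤ r / ℓ := by positivity
  have h1 : (1 + r / ℓ : ℝ) ^ t ≤ (1 + r / ℓ : ℝ) ^ T :=
    pow_le_pow_right₀ (by linarith) ht
  have h2 : (2 : ℝ) ^ ℓ * (1 / 2 : ℝ) ^ D.card ≤ (1 / 2) ^ ℓ := by
    calc (2 : ℝ) ^ ℓ * (1 / 2 : ℝ) ^ D.card ≤ 2 ^ ℓ * (1 / 2 : ℝ) ^ (2 * ℓ) := by
          gcongr ?_ * ?_
          exact pow_le_pow_of_le_one (by norm_num) (by norm_num) hD
      _ = _ := by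
          rw [two_mul, pow_add, ← mul_assoc, ← mul_pow]; norm_num
  gcongr

end RandomAttack

/-! ### Adversaries against small states -/

section Outcome

variable {u n : ℕ} (A : AMQ u n)

theorem measurableSet_fail (adv : Adversary u) (k : ℕ) :
    MeasurableSet {ρ | A.peakSpace adv ρ < k ∧ ¬ A.Wins adv ρ} := by
  have h1 : MeasurableFibres fun ρ => A.peakSpace adv ρ :=
    (measurableFibres_start A.toAMQFunctions).bind
      (g := fun ρ σ => A.peakFrom n ρ adv σ) (measurableFibres_peakFrom A.toAMQFunctions n adv)
  have h2 : MeasurableFibres fun ρ => A.Wins adv ρ :=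
    (measurableFibres_start A.toAMQFunctions).bind
      (g := fun ρ σ => A.winsFrom n ρ adv σ) (measurableFibres_winsFrom A.toAMQFunctions n adv)
  exact (h1.measurableSet fun p => p < k).inter (h2.measurableSet fun p => ¬ p)

theorem measurableSet_peakSpace_lt (adv : Adversary u) (k : ℕ) :
    MeasurableSet {ρ | A.peakSpace adv ρ < k} := by
  have h1 : MeasurableFibres fun ρ => A.peakSpace adv ρ :=
    (measurableFibres_start A.toAMQFunctions).bind
      (g := fun ρ σ => A.peakFrom n ρ adv σ) (measurableFibres_peakFrom A.toAMQFunctions n adv)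
  exact h1.measurableSet fun p => p < k

theorem measurableSet_few_positive (adv : Adversary u) (k m T : ℕ) :
    MeasurableSet {ρ | A.peakSpace adv ρ < k ∧ (A.answers adv ρ).count true + m < T} := by
  have h2 : MeasurableFibres fun ρ => A.answers adv ρ :=
    (measurableFibres_start A.toAMQFunctions).bind
      (g := fun ρ σ => A.answersFrom n ρ adv σ)
      (measurableFibres_answersFrom A.toAMQFunctions n adv)
  exact (measurableSet_peakSpace_lt A adv k).inter
    (h2.measurableSet fun p => p.count true + m < T)

open Classical in
/-- For a fixed random string, the sum over insertions, queries and lengths of the attack of the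
probability that the state remains small and the output is not a false positive. -/
theorem sum_attackMean_fail_le_of_card {F : AMQFunctions u} {ρ : Coins} {m d r k ℓ K : ℕ}
    {η Λ : ℝ} (σ : (Fin n → Fin u) → OracleState u) (x₀ : Fin u) (hℓ : 1 ≤ ℓ) (hd : 2 * ℓ ≤ d)
    (hK : 1 ≤ K) (hΛ : (1 + r / ℓ : ℝ) ^ (m * K) * (1 / 2) ^ ℓ ≤ Λ)
    (hbad : ((Finset.univ.filter fun sQ : (Fin n → Fin u) × (Fin m → Fin u) =>
        (σ sQ.1).space < k ∧
        ¬ ∃ D : Finset (Fin m), d ≤ D.card ∧ Unexcludable F ρ sQ.2 (σ sQ.1) D r k).card : ℝ)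
      ≤ η * ((u : ℝ) ^ n * (u : ℝ) ^ m)) :
    ∑ sQ : (Fin n → Fin u) × (Fin m → Fin u), ∑ t : Fin (m * K),
      attackMean sQ.2 x₀ (t : ℕ) Finset.univ (fun a =>
          if F.peakFrom n ρ a (σ sQ.1) < k ∧ ¬ F.winsFrom n ρ a (σ sQ.1) then (1 : ℝ) else 0)
      ≤ (m * K : ℕ) * ((u : ℝ) ^ n * (u : ℝ) ^ m) * (η + 1 / K + Λ) := by
  set T := m * K with hT
  have hΛ0 : 0 ≤ Λ := le_trans (by positivity) hΛ
  have hsum := sum_le_card_mul_of_exceptional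
    (fun sQ : (Fin n → Fin u) × (Fin m → Fin u) => (σ sQ.1).space < k ∧
      ¬ ∃ D : Finset (Fin m), d ≤ D.card ∧ Unexcludable F ρ sQ.2 (σ sQ.1) D r k)
    (fun sQ => ∑ t : Fin T, attackMean sQ.2 x₀ (t : ℕ) Finset.univ fun a =>
      if F.peakFrom n ρ a (σ sQ.1) < k ∧ ¬ F.winsFrom n ρ a (σ sQ.1) then (1 : ℝ) else 0)
    (X := T) (Λ := m + T * Λ) (by positivity)
    (by
      intro sQ
      calc _ ≤ ∑ t : Fin T, attackMean sQ.2 x₀ (t : ℕ) Finset.univ fun _ => (1 : ℝ) :=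
            Finset.sum_le_sum fun t _ => attackMean_mono _ _ _ _ fun a => by
              split_ifs <;> norm_num
        _ = T := by simp [attackMean_const])
    (by
      intro sQ hsQ
      by_cases hk : (σ sQ.1).space < k
      · have : ∃ D : Finset (Fin m), d ≤ D.card ∧
            Unexcludable F ρ sQ.2 (σ sQ.1) D r k := by
          by_contra h; exact hsQ ⟨hk, h⟩
        obtain ⟨D, hD, hun⟩ := this
        have h := sum_attackMean_fail_le (F := F) n x₀ hℓ T (σ sQ.1) Finset.univ hun
        rw [Finset.sum_range] at h
        refine h.trans ?_
        rw [Finset.card_univ, Fintype.card_fin]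
        gcongr
        calc _ ≤ ∑ t ∈ Finset.range T, Λ := Finset.sum_le_sum fun t ht =>
              potential_le_of_card (hd.trans hD) (Finset.mem_range.1 ht).le hΛ
          _ = T * Λ := by simp
      · refine le_trans (Finset.sum_nonpos fun t _ => ?_) (by positivity)
        calc _ ≤ attackMean sQ.2 x₀ (t : ℕ) Finset.univ fun _ => (0 : ℝ) :=
              attackMean_mono _ _ _ _ fun a => by
                rw [if_neg]
                exact fun h => hk ((space_le_peakFrom n a _).trans_lt h.1)
          _ = 0 := attackMean_const _ _ _ _ _
          _ ≤ 0 := le_rfl)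
  refine hsum.trans ?_
  have hcard : (Fintype.card ((Fin n → Fin u) × (Fin m → Fin u)) : ℝ)
      = (u : ℝ) ^ n * (u : ℝ) ^ m := by simp
  rw [hcard]
  have hTm : (m : ℝ) = T * (1 / K) := by
    have : (K : ℝ) ≠ 0 := by positivity
    rw [hT]; push_cast; field_simp
  have hb' := mul_le_mul_of_nonneg_right hbad (Nat.cast_nonneg (α := ℝ) T)
  rw [hTm]
  refine (add_le_add hb' le_rfl).trans (le_of_eq ?_)
  ring

open Classical in
/-- For a fixed random string, the sum over insertions and queries of the probability that the
state remains small and there are fewer than `T - m` positive answers. -/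
theorem sum_attackMean_few_positive_le_of_card {F : AMQFunctions u} {ρ : Coins} {m d r k ℓ T : ℕ}
    {η Λ : ℝ} (σ : (Fin n → Fin u) → OracleState u) (x₀ : Fin u) (hℓ : 1 ≤ ℓ) (hd : 2 * ℓ ≤ d)
    (hΛ : (1 + r / ℓ : ℝ) ^ T * (1 / 2) ^ ℓ ≤ Λ)
    (hbad : ((Finset.univ.filter fun sQ : (Fin n → Fin u) × (Fin m → Fin u) =>
        (σ sQ.1).space < k ∧
        ¬ ∃ D : Finset (Fin m), d ≤ D.card ∧ Unexcludable F ρ sQ.2 (σ sQ.1) D r k).card : ℝ)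
      ≤ η * ((u : ℝ) ^ n * (u : ℝ) ^ m)) :
    ∑ sQ : (Fin n → Fin u) × (Fin m → Fin u),
      attackMean sQ.2 x₀ T Finset.univ (fun a =>
          if F.peakFrom n ρ a (σ sQ.1) < k ∧
            (F.answersFrom n ρ a (σ sQ.1)).count true + m < T then (1 : ℝ) else 0)
      ≤ ((u : ℝ) ^ n * (u : ℝ) ^ m) * (η + Λ) := by
  have hΛ0 : 0 ≤ Λ := le_trans (by positivity) hΛ
  have hsum := sum_le_card_mul_of_exceptional
    (fun sQ : (Fin n → Fin u) × (Fin m → Fin u) => (σ sQ.1).space < k ∧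
      ¬ ∃ D : Finset (Fin m), d ≤ D.card ∧ Unexcludable F ρ sQ.2 (σ sQ.1) D r k)
    (fun sQ => attackMean sQ.2 x₀ T Finset.univ fun a =>
      if F.peakFrom n ρ a (σ sQ.1) < k ∧
        (F.answersFrom n ρ a (σ sQ.1)).count true + m < T then (1 : ℝ) else 0)
    (X := 1) (Λ := Λ) hΛ0
    (by
      intro sQ
      calc _ ≤ attackMean sQ.2 x₀ T Finset.univ fun _ => (1 : ℝ) :=
            attackMean_mono _ _ _ _ fun a => by split_ifs <;> norm_num
        _ = 1 := attackMean_const _ _ _ _ _)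
    (by
      intro sQ hsQ
      by_cases hk : (σ sQ.1).space < k
      · have : ∃ D : Finset (Fin m), d ≤ D.card ∧
            Unexcludable F ρ sQ.2 (σ sQ.1) D r k := by
          by_contra h; exact hsQ ⟨hk, h⟩
        obtain ⟨D, hD, hun⟩ := this
        have h := attackMean_few_positive_le (F := F) n x₀ hℓ T (σ sQ.1) Finset.univ hun
        rw [Finset.card_univ, Fintype.card_fin] at h
        exact h.trans (potential_le_of_card (hd.trans hD) le_rfl hΛ)
      · calc _ ≤ attackMean sQ.2 x₀ T Finset.univ fun _ => (0 : ℝ) :=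
              attackMean_mono _ _ _ _ fun a => by
                rw [if_neg]
                exact fun h => hk ((space_le_peakFrom n a _).trans_lt h.1)
          _ = 0 := attackMean_const _ _ _ _ _
          _ ≤ Λ := hΛ0)
  refine hsum.trans ?_
  have hcard : (Fintype.card ((Fin n → Fin u) × (Fin m → Fin u)) : ℝ)
      = (u : ℝ) ^ n * (u : ℝ) ^ m := by simp
  rw [hcard]
  linarith

open Classical in
/-- If most pairs of insertions and queries are unexcludable whatever the random string is, then
some adversary wins whenever the state remains small, but for a small probability. -/
theorem exists_adversary_fail_le {m d r k ℓ K : ℕ} {η Λ : ℝ} (hm : 1 ≤ m) (hu : 0 < u)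
    (hℓ : 1 ≤ ℓ) (hd : 2 * ℓ ≤ d) (hK : 1 ≤ K)
    (hΛ : (1 + r / ℓ : ℝ) ^ (m * K) * (1 / 2) ^ ℓ ≤ Λ)
    (hbad : ∀ ρ,
      ((Finset.univ.filter fun sQ : (Fin n → Fin u) × (Fin m → Fin u) =>
        (afterInsertions A.toAMQFunctions n ρ (List.ofFn sQ.1)).space < k ∧
        ¬ ∃ D : Finset (Fin m), d ≤ D.card ∧ Unexcludable A.toAMQFunctions ρ sQ.2
          (afterInsertions A.toAMQFunctions n ρ (List.ofFn sQ.1)) D r k).card : ℝ)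
      ≤ η * ((u : ℝ) ^ n * (u : ℝ) ^ m)) :
    ∃ adv : Adversary u,
      coinMeasure.real {ρ | A.peakSpace adv ρ < k ∧ ¬ A.Wins adv ρ} ≤ η + 1 / K + Λ := by
  let x₀ : Fin u := ⟨0, hu⟩
  have : Nonempty (Fin (m * K)) := ⟨⟨0, Nat.mul_pos hm hK⟩⟩
  have : Nonempty (Fin u) := ⟨x₀⟩
  let full : (Fin n → Fin u) → Adversary u → Adversary u :=
    fun s a => (List.ofFn s).foldr Adversary.insert a
  obtain ⟨i, a, -, hia⟩ := exists_integral_le_of_sum_attackMean_le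
    (fun i : Fin (m * K) × ((Fin n → Fin u) × (Fin m → Fin u)) => i.2.2) x₀ (fun i => (i.1 : ℕ))
    Finset.univ (fun i a => Set.indicator
      {ρ | A.peakSpace (full i.2.1 a) ρ < k ∧ ¬ A.Wins (full i.2.1 a) ρ} 1)
    (fun i a => (integrable_const (1 : ℝ)).indicator (measurableSet_fail A _ k))
    (β := η + 1 / K + Λ) (by
      intro ρ
      have hle := fun i : Fin (m * K) × ((Fin n → Fin u) × (Fin m → Fin u)) =>
        attackMean_mono i.2.2 x₀ (i.1 : ℕ) (Finset.univ : Finset (Fin m))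
        (f := fun a => Set.indicator
          {ρ | A.peakSpace (full i.2.1 a) ρ < k ∧ ¬ A.Wins (full i.2.1 a) ρ} 1 ρ)
        (g := fun a => if A.peakFrom n ρ a
            (afterInsertions A.toAMQFunctions n ρ (List.ofFn i.2.1)) < k ∧
          ¬ A.winsFrom n ρ a (afterInsertions A.toAMQFunctions n ρ (List.ofFn i.2.1))
          then (1 : ℝ) else 0) (by
            intro a
            simp only [Set.indicator_apply, Set.mem_ofPred_eq, Pi.one_apply]
            split_ifs with h h'
            · exact le_rfl
            · refine absurd ⟨(peakFrom_le_peakFrom_foldr_insert _ n ρ a _ _).trans_lt h.1, ?_⟩ h'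
              intro hw
              refine h.2 ?_
              show A.winsFrom n ρ ((List.ofFn i.2.1).foldr Adversary.insert a) (A.start ρ)
              rw [winsFrom_foldr_insert]
              exact hw
            · norm_num
            · exact le_rfl)
      refine (Finset.sum_le_sum fun i _ => hle i).trans ?_
      rw [Fintype.sum_prod_type_right]
      have hcard : (Fintype.card (Fin (m * K) × ((Fin n → Fin u) × (Fin m → Fin u))) : ℝ)
          = (m * K : ℕ) * ((u : ℝ) ^ n * (u : ℝ) ^ m) := by
        rw [Fintype.card_prod, Fintype.card_prod]; simp
      rw [hcard]
      exact sum_attackMean_fail_le_of_card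
        (fun s => afterInsertions A.toAMQFunctions n ρ (List.ofFn s)) x₀ hℓ hd hK hΛ (hbad ρ))
  refine ⟨full i.2.1 a, ?_⟩
  rwa [integral_indicator_one (measurableSet_fail A _ k)] at hia

open Classical in
/-- If most pairs of insertions and queries are unexcludable whatever the random string is, then
there are insertions followed by lookups of other elements most of which are answered positively
whenever the state remains small, but for a small probability. -/
theorem exists_adversary_few_positive_le {m d r k ℓ T : ℕ} {η η' Λ : ℝ} (hm : 1 ≤ m) (hu : 0 < u)
    (hℓ : 1 ≤ ℓ) (hd : 2 * ℓ ≤ d)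
    (hΛ : (1 + r / ℓ : ℝ) ^ T * (1 / 2) ^ ℓ ≤ Λ)
    (h5 : (n * m : ℝ) ≤ η' * u) (hlt : η' + η + Λ < 1)
    (hbad : ∀ ρ,
      ((Finset.univ.filter fun sQ : (Fin n → Fin u) × (Fin m → Fin u) =>
        (afterInsertions A.toAMQFunctions n ρ (List.ofFn sQ.1)).space < k ∧
        ¬ ∃ D : Finset (Fin m), d ≤ D.card ∧ Unexcludable A.toAMQFunctions ρ sQ.2
          (afterInsertions A.toAMQFunctions n ρ (List.ofFn sQ.1)) D r k).card : ℝ)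
      ≤ η * ((u : ℝ) ^ n * (u : ℝ) ^ m)) :
    ∃ (s : Fin n → Fin u) (q : Fin m → Fin u) (a : Adversary u), (∀ i j, s i ≠ q j) ∧
      OnlyLookups q T a ∧
      coinMeasure.real {ρ | A.peakSpace ((List.ofFn s).foldr Adversary.insert a) ρ < k ∧
        (A.answers ((List.ofFn s).foldr Adversary.insert a) ρ).count true + m < T}
        ≤ η' + η + Λ := by
  let x₀ : Fin u := ⟨0, hu⟩
  have : Nonempty (Fin u) := ⟨x₀⟩
  let full : (Fin n → Fin u) → Adversary u → Adversary u :=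
    fun s a => (List.ofFn s).foldr Adversary.insert a
  let hit : (Fin n → Fin u) × (Fin m → Fin u) → ℝ :=
    fun sQ => if ∃ i j, sQ.1 i = sQ.2 j then 1 else 0
  let E : (Fin n → Fin u) → Adversary u → Set Coins := fun s a =>
    {ρ | A.peakSpace (full s a) ρ < k ∧ (A.answers (full s a) ρ).count true + m < T}
  have hE : ∀ s a, MeasurableSet (E s a) := fun s a => measurableSet_few_positive A _ k m T
  have hEint : ∀ s a, Integrable (Set.indicator (E s a) (1 : Coins → ℝ)) coinMeasure :=
    fun s a => (integrable_const (1 : ℝ)).indicator (hE s a)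
  obtain ⟨⟨s, q⟩, a, ha, hia⟩ := exists_integral_le_of_sum_attackMean_le
    (fun i : (Fin n → Fin u) × (Fin m → Fin u) => i.2) x₀ (fun _ => T)
    -- The maximum with `hit` makes the pair that is found miss each other.
    Finset.univ (fun i a ρ => max (hit i) (Set.indicator (E i.1 a) 1 ρ))
    (fun i a => (integrable_const _).sup (hEint i.1 a))
    (β := η' + η + Λ) (by
      intro ρ
      have hle := fun i : (Fin n → Fin u) × (Fin m → Fin u) =>
        show attackMean i.2 x₀ T (Finset.univ : Finset (Fin m))
          (fun a => max (hit i) (Set.indicator (E i.1 a) 1 ρ)) ≤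
          hit i + attackMean i.2 x₀ T (Finset.univ : Finset (Fin m))
        (fun a => if A.peakFrom n ρ a
            (afterInsertions A.toAMQFunctions n ρ (List.ofFn i.1)) < k ∧
          (A.answersFrom n ρ a
            (afterInsertions A.toAMQFunctions n ρ (List.ofFn i.1))).count true + m < T
          then (1 : ℝ) else 0) from by
          by_cases hi : ∃ j j', i.1 j = i.2 j'
          · have h1 : hit i = 1 := if_pos hi
            have h2 : attackMean i.2 x₀ T (Finset.univ : Finset (Fin m))
                (fun a => max (hit i) (Set.indicator (E i.1 a) 1 ρ)) ≤ 1 := by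
              calc _ ≤ attackMean i.2 x₀ T Finset.univ fun _ => (1 : ℝ) :=
                    attackMean_mono _ _ _ _ fun a => by
                      rw [h1]
                      refine max_le le_rfl ?_
                      rw [Set.indicator_apply]
                      split_ifs <;> norm_num
                _ = 1 := attackMean_const _ _ _ _ _
            have h3 : 0 ≤ attackMean i.2 x₀ T (Finset.univ : Finset (Fin m))
                (fun a => if A.peakFrom n ρ a
                  (afterInsertions A.toAMQFunctions n ρ (List.ofFn i.1)) < k ∧
                  (A.answersFrom n ρ a
                    (afterInsertions A.toAMQFunctions n ρ (List.ofFn i.1))).count true + m < T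
                  then (1 : ℝ) else 0) := by
              calc (0 : ℝ) = attackMean i.2 x₀ T Finset.univ fun _ => (0 : ℝ) :=
                    (attackMean_const _ _ _ _ _).symm
                _ ≤ _ := attackMean_mono _ _ _ _ fun a => by split_ifs <;> norm_num
            linarith
          · have h1 : hit i = 0 := if_neg hi
            rw [h1, zero_add]
            refine attackMean_mono _ _ _ _ fun a => ?_
            refine max_le (by split_ifs <;> norm_num) ?_
            simp only [Set.indicator_apply, Pi.one_apply]
            split_ifs with h h'
            · exact le_rfl
            · refine absurd ⟨(peakFrom_le_peakFrom_foldr_insert _ n ρ a _ _).trans_lt h.1, ?_⟩ h'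
              have h2 := h.2
              change (A.answersFrom n ρ ((List.ofFn i.1).foldr Adversary.insert a)
                (A.start ρ)).count true + m < T at h2
              rw [answersFrom_foldr_insert] at h2
              exact h2
            · norm_num
            · exact le_rfl
      refine (Finset.sum_le_sum fun i _ => hle i).trans ?_
      rw [Finset.sum_add_distrib]
      have hcard : (Fintype.card ((Fin n → Fin u) × (Fin m → Fin u)) : ℝ)
          = (u : ℝ) ^ n * (u : ℝ) ^ m := by
        rw [Fintype.card_prod]; simp
      rw [hcard]
      have h6 : ∑ i, hit i ≤ η' * ((u : ℝ) ^ n * (u : ℝ) ^ m) := by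
        have := card_pairs_hitting_le (U := Fin u) (n := n) (m := m) (η := η') hm
          (by simpa using hu) (by simpa using h5)
        simp only [hit, Finset.sum_boole]
        simpa using this
      have h7 := sum_attackMean_few_positive_le_of_card
        (fun s => afterInsertions A.toAMQFunctions n ρ (List.ofFn s)) x₀ hℓ hd hΛ (hbad ρ)
      linarith)
  have h8 : ∀ c : ℝ, (∀ ρ, c ≤ max (hit (s, q)) (Set.indicator (E s a) 1 ρ)) →
      c ≤ η' + η + Λ := by
    intro c hc
    refine le_trans ?_ hia
    calc c = ∫ _, c ∂coinMeasure := by simp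
      _ ≤ _ := integral_mono (integrable_const _) ((integrable_const _).sup (hEint s a)) hc
  refine ⟨s, q, a, ?_, ha, ?_⟩
  · intro i j hij
    have h1 : hit (s, q) = 1 := if_pos ⟨i, j, hij⟩
    have := h8 1 fun ρ => by rw [h1]; exact le_max_left _ _
    linarith
  · refine le_trans ?_ hia
    rw [← integral_indicator_one (hE s a)]
    exact integral_mono (hEint s a) ((integrable_const _).sup (hEint s a))
      fun ρ => le_max_right _ _

end Outcome

/-! ### Choice of parameters -/

section Parameters

/- Throughout, `b` is about `n ^ (1 / 12)`; there are `2 * n * b ^ 5` queries, of which a fraction of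
about `1 / b` is popular, and at most `n` queries can be excluded by a state of fewer than `k` bits,
where `k` is about `n * logb 2 n / 480`, so that there are at most about `b ^ (n / 10)` such states. -/

theorem log_bounds_of_large {b : ℕ} (hb : 2 ^ 20 ≤ b) :
    13 ≤ Real.log b ∧ 60 * Real.log b + 2 ≤ b := by
  have hb' : (2 : ℝ) ^ 20 ≤ b := by exact_mod_cast hb
  have hpos : (0 : ℝ) < b := lt_of_lt_of_le (by positivity) hb'
  have hl2 := Real.log_two_gt_d9
  have hl2' := Real.log_two_lt_d9
  constructor
  · have := Real.log_le_log (by positivity) hb'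
    rw [Real.log_pow] at this
    push_cast at this
    linarith
  · have h1 := Real.log_le_sub_one_of_pos (x := b / 2 ^ 10) (by positivity)
    rw [Real.log_div hpos.ne' (by positivity), Real.log_pow] at h1
    push_cast at h1
    norm_num at h1
    have hb'' : (1048576 : ℝ) ≤ b := by
      have : 1048576 ≤ b := by omega
      exact_mod_cast this
    linarith

theorem twenty_mul_lt_exp {n : ℕ} (hn : 40 ≤ n) : 20 * (n : ℝ) < Real.exp n := by
  have hn' : (40 : ℝ) ≤ n := by exact_mod_cast hn
  have := Real.quadratic_le_exp_of_nonneg (x := n) (by linarith)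
  nlinarith

theorem exp_neg_le {n : ℕ} (hn : 40 ≤ n) {x : ℝ} (hx : x ≤ -n) :
    Real.exp x ≤ 1 / (20 * n) := by
  have hn' : (40 : ℝ) ≤ n := by exact_mod_cast hn
  calc Real.exp x ≤ Real.exp (-n) := Real.exp_le_exp.2 hx
    _ = 1 / Real.exp n := by rw [Real.exp_neg, one_div]
    _ ≤ 1 / (20 * n) := one_div_le_one_div_of_le (by linarith) (twenty_mul_lt_exp hn).le

variable {n b k : ℕ}

theorem log_le_of_lt_pow (hb : 2 ^ 20 ≤ b) (hn : 0 < n) (hn2 : n < (b + 1) ^ 12) :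
    Real.log n ≤ 24 * Real.log b := by
  have h1 : b + 1 ≤ b ^ 2 := by nlinarith
  have h2 : n ≤ b ^ 24 := by
    calc n ≤ (b + 1) ^ 12 := hn2.le
      _ ≤ (b ^ 2) ^ 12 := Nat.pow_le_pow_left h1 _
      _ = b ^ 24 := by rw [← pow_mul]
  have h3 : (n : ℝ) ≤ (b : ℝ) ^ 24 := by exact_mod_cast h2
  have h4 := Real.log_le_log (by exact_mod_cast hn) h3
  rw [Real.log_pow] at h4
  exact_mod_cast h4

/-- The number of small states is at most about `b ^ (n / 10)`. -/
theorem four_pow_le_exp (hb : 2 ^ 20 ≤ b) (hn : 0 < n) (hn2 : n < (b + 1) ^ 12)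
    (hk : (k : ℝ) ≤ 1 / 480 * (n * Real.logb 2 n) + 1) :
    (4 : ℝ) ^ k ≤ Real.exp (n * Real.log b / 10 + 2) := by
  have hl2 : 0 < Real.log 2 := Real.log_pos (by norm_num)
  have h4 : Real.log 4 = 2 * Real.log 2 := by
    rw [show (4 : ℝ) = 2 ^ 2 by norm_num, Real.log_pow]; norm_num
  have hlog := log_le_of_lt_pow hb hn hn2
  rw [← Real.exp_log (show (0 : ℝ) < 4 by norm_num), ← Real.exp_nat_mul, Real.exp_le_exp, h4]
  have h5 : Real.logb 2 n * Real.log 2 = Real.log n := by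
    rw [Real.logb, div_mul_cancel₀ _ hl2.ne']
  have hl2' := Real.log_two_lt_d9
  have hn0 : (0 : ℝ) ≤ n := by positivity
  calc (k : ℝ) * (2 * Real.log 2) ≤ (1 / 480 * (n * Real.logb 2 n) + 1) * (2 * Real.log 2) := by
        gcongr
    _ = 1 / 240 * (n * (Real.logb 2 n * Real.log 2)) + 2 * Real.log 2 := by ring
    _ = 1 / 240 * (n * Real.log n) + 2 * Real.log 2 := by rw [h5]
    _ ≤ 1 / 240 * (n * (24 * Real.log b)) + 2 := by
        gcongr; linarith
    _ = _ := by ring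

/-- A fibre that is not negligible has at least a fraction `1 / b` of popular elements. -/
theorem light_fibre_parameter (hb : 2 ^ 20 ≤ b) (hn1 : b ^ 12 ≤ n) (hn2 : n < (b + 1) ^ 12)
    (hk : (k : ℝ) ≤ 1 / 480 * (n * Real.logb 2 n) + 1) :
    2 * 2 ^ n * (1 / b : ℝ) ^ (n / 2) * 4 ^ k < 1 / (20 * n) := by
  have hbn : b ≤ n := le_trans (Nat.le_self_pow (by norm_num) b) hn1
  have hn40 : 40 ≤ n := by omega
  have hn' : (1048576 : ℝ) ≤ n := by
    have : 1048576 ≤ n := by omega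
    exact_mod_cast this
  have hb' : (0 : ℝ) < b := by
    have : 0 < b := by omega
    exact_mod_cast this
  obtain ⟨hβ, -⟩ := log_bounds_of_large hb
  have h4 := four_pow_le_exp hb (by omega) hn2 hk
  have hl2' := Real.log_two_lt_d9
  have h2 : (2 : ℝ) * 2 ^ n ≤ Real.exp (n + 1) := by
    rw [← pow_succ', ← Real.exp_log (show (0 : ℝ) < 2 by norm_num), ← Real.exp_nat_mul,
      Real.exp_le_exp]
    push_cast
    have : (0 : ℝ) ≤ n + 1 := by positivity
    nlinarith
  have h3 : (1 / b : ℝ) ^ (n / 2) ≤ Real.exp (-(Real.log b * ((n - 1) / 2))) := by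
    have : (1 / b : ℝ) = Real.exp (-Real.log b) := by
      rw [Real.exp_neg, Real.exp_log hb', one_div]
    rw [this, ← Real.exp_nat_mul, Real.exp_le_exp]
    have h5 : ((n : ℝ) - 1) / 2 ≤ ((n / 2 : ℕ) : ℝ) := by
      have : n ≤ 2 * (n / 2) + 1 := by omega
      have : (n : ℝ) ≤ 2 * ((n / 2 : ℕ) : ℝ) + 1 := by exact_mod_cast this
      linarith
    nlinarith
  calc _ ≤ Real.exp (n + 1) * Real.exp (-(Real.log b * ((n - 1) / 2)))
        * Real.exp (n * Real.log b / 10 + 2) := by gcongr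
    _ = Real.exp (n + 1 + -(Real.log b * ((n - 1) / 2)) + (n * Real.log b / 10 + 2)) := by
        rw [← Real.exp_add, ← Real.exp_add]
    _ ≤ Real.exp (-n) := by
        rw [Real.exp_le_exp]
        nlinarith [mul_le_mul_of_nonneg_right hβ (show (0 : ℝ) ≤ n - 10 by linarith)]
    _ < _ := by
        rw [Real.exp_neg, ← one_div]
        exact one_div_lt_one_div_of_lt (by linarith) (twenty_mul_lt_exp hn40)

/-- It is rare that fewer than `2 * (n * b ^ 3)` of the queries are popular. -/
theorem few_popular_parameter (hb : 2 ^ 20 ≤ b) (hn1 : b ^ 12 ≤ n) (hn2 : n < (b + 1) ^ 12) :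
    ((2 * n * b ^ 5).choose (2 * n * b ^ 5 - 2 * (n * b ^ 3)) : ℝ)
      * (1 - 1 / b) ^ (2 * n * b ^ 5 - 2 * (n * b ^ 3)) ≤ 1 / (20 * n) := by
  have hbn : b ≤ n := le_trans (Nat.le_self_pow (by norm_num) b) hn1
  have hn40 : 40 ≤ n := by omega
  have hb1 : (1 : ℝ) ≤ b := by
    have : 1 ≤ b := by omega
    exact_mod_cast this
  have hb' : (0 : ℝ) < b := by linarith
  have hn' : (0 : ℝ) < n := by
    have : 0 < n := by omega
    exact_mod_cast this
  obtain ⟨hβ, hβb⟩ := log_bounds_of_large hb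
  have hlog := log_le_of_lt_pow hb (by omega) hn2
  set m := 2 * n * b ^ 5 with hm
  set d := 2 * (n * b ^ 3) with hd
  have hdm : d ≤ m := by
    rw [hd, hm, mul_assoc]
    gcongr
    · omega
    · norm_num
  have hmR : (m : ℝ) = 2 * n * (b : ℝ) ^ 5 := by rw [hm]; push_cast; ring
  have hdR : (d : ℝ) = 2 * (n * (b : ℝ) ^ 3) := by rw [hd]; push_cast; ring
  have hmpos : (0 : ℝ) < m := by rw [hmR]; positivity
  have hlogm : Real.log m ≤ 30 * Real.log b := by
    rw [hmR, Real.log_mul (by positivity) (by positivity), Real.log_mul (by norm_num) hn'.ne',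
      Real.log_pow]
    have := Real.log_two_lt_d9
    push_cast
    linarith
  have h1 : (m.choose (m - d) : ℝ) ≤ Real.exp (d * (30 * Real.log b)) := by
    rw [Nat.choose_symm hdm]
    calc (m.choose d : ℝ) ≤ (m : ℝ) ^ d := by exact_mod_cast Nat.choose_le_pow m d
      _ = Real.exp (d * Real.log m) := by rw [Real.exp_nat_mul, Real.exp_log hmpos]
      _ ≤ _ := by rw [Real.exp_le_exp]; gcongr
  have h0 : (0 : ℝ) ≤ 1 - 1 / b := by
    rw [sub_nonneg, div_le_one hb']; exact hb1
  have h2 : (1 - 1 / b : ℝ) ^ (m - d) ≤ Real.exp (-((m - d) / b)) := by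
    calc (1 - 1 / b : ℝ) ^ (m - d) ≤ (Real.exp (-(1 / b))) ^ (m - d) := by
          gcongr
          exact Real.one_sub_le_exp_neg _
      _ = _ := by
          rw [← Real.exp_nat_mul, Nat.cast_sub hdm]
          congr 1
          ring
  calc _ ≤ Real.exp (d * (30 * Real.log b)) * Real.exp (-((m - d) / b)) := by gcongr
    _ = Real.exp (d * (30 * Real.log b) + -((m - d) / b)) := by rw [Real.exp_add]
    _ ≤ 1 / (20 * n) := by
        refine exp_neg_le hn40 ?_
        have e : ((m : ℝ) - d) / b = n * (2 * (b : ℝ) ^ 4 - 2 * (b : ℝ) ^ 2) := by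
          rw [hmR, hdR]; field_simp
        rw [e, hdR]
        have h3 : (b : ℝ) ^ 3 * (60 * Real.log b + 2) ≤ (b : ℝ) ^ 3 * b := by gcongr
        have h4 : (b : ℝ) ^ 2 ≤ (b : ℝ) ^ 3 := pow_le_pow_right₀ hb1 (by norm_num)
        have h5 : (1 : ℝ) ≤ (b : ℝ) ^ 4 := one_le_pow₀ hb1
        have h6 : 60 * (b : ℝ) ^ 3 * Real.log b + 2 * (b : ℝ) ^ 2 + 1 ≤ 2 * (b : ℝ) ^ 4 := by
          nlinarith
        nlinarith [mul_le_mul_of_nonneg_left h6 hn'.le]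

/-- It is rare that some small state excludes a set of density at most `160 * b ^ 5 / n` that
contains `n` of the queries. -/
theorem many_excluded_parameter (hb : 2 ^ 20 ≤ b) (hn1 : b ^ 12 ≤ n) (hn2 : n < (b + 1) ^ 12)
    (hk : (k : ℝ) ≤ 1 / 480 * (n * Real.logb 2 n) + 1) :
    4 ^ k * (((2 * n * b ^ 5).choose n : ℝ) * (160 * b ^ 5 / n) ^ n) ≤ 1 / (20 * n) := by
  have hbn : b ≤ n := le_trans (Nat.le_self_pow (by norm_num) b) hn1
  have hn40 : 40 ≤ n := by omega
  have hb' : (0 : ℝ) < b := by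
    have : 0 < b := by omega
    exact_mod_cast this
  have hn' : (40 : ℝ) ≤ n := by exact_mod_cast hn40
  have hn0 : (0 : ℝ) < n := by linarith
  obtain ⟨hβ, -⟩ := log_bounds_of_large hb
  have h4 := four_pow_le_exp hb (by omega) hn2 hk
  have hn1' : (b : ℝ) ^ 12 ≤ n := by exact_mod_cast hn1
  have hch : ((2 * n * b ^ 5).choose n : ℝ) ≤ (Real.exp 1 * (2 * b ^ 5)) ^ n := by
    have h1 : ((2 * n * b ^ 5).choose n : ℝ) ≤ ((2 * n * b ^ 5 : ℕ) : ℝ) ^ n / (n.factorial : ℝ) :=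
      Nat.choose_le_pow_div n (2 * n * b ^ 5)
    have h2 := Real.pow_div_factorial_le_exp (n : ℝ) hn0.le n
    calc _ ≤ _ := h1
      _ = (2 * b ^ 5 : ℝ) ^ n * ((n : ℝ) ^ n / n.factorial) := by
          push_cast
          rw [show (2 * n * b ^ 5 : ℝ) = (2 * b ^ 5) * n by ring, mul_pow]
          ring
      _ ≤ (2 * b ^ 5 : ℝ) ^ n * Real.exp n := by gcongr
      _ = _ := by rw [mul_pow (Real.exp 1), ← Real.exp_nat_mul, mul_one, mul_comm]
  have h320 : (320 : ℝ) ≤ Real.exp 6 := by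
    have h := Real.exp_one_gt_d9
    have h' : (2.7 : ℝ) ≤ Real.exp 1 := by linarith
    have : (2.7 : ℝ) ^ 6 ≤ Real.exp 1 ^ 6 := by gcongr
    rw [← Real.exp_nat_mul] at this
    norm_num at this ⊢
    linarith
  have hbase : Real.exp 1 * (2 * b ^ 5) * (160 * b ^ 5 / n) ≤ Real.exp (7 - 2 * Real.log b) := by
    have e : Real.exp (7 - 2 * Real.log b) = Real.exp 1 * Real.exp 6 / b ^ 2 := by
      rw [Real.exp_sub, ← Real.exp_add, show (2 : ℝ) * Real.log b = ((2 : ℕ) : ℝ) * Real.log b by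
        norm_num, Real.exp_nat_mul, Real.exp_log hb']
      norm_num
    rw [e]
    calc Real.exp 1 * (2 * b ^ 5) * (160 * b ^ 5 / n) = Real.exp 1 * 320 * (b ^ 10 / n) := by
          ring
      _ ≤ Real.exp 1 * Real.exp 6 * (1 / b ^ 2) := by
          gcongr ?_ * ?_
          · gcongr
          · rw [div_le_div_iff₀ hn0 (by positivity)]
            calc (b : ℝ) ^ 10 * (b : ℝ) ^ 2 = (b : ℝ) ^ 12 := by ring
              _ ≤ 1 * (n : ℝ) := by linarith
      _ = _ := by ring
  calc _ ≤ Real.exp (n * Real.log b / 10 + 2) *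
        ((Real.exp 1 * (2 * b ^ 5)) ^ n * (160 * b ^ 5 / n) ^ n) := by gcongr
    _ = Real.exp (n * Real.log b / 10 + 2) *
        (Real.exp 1 * (2 * b ^ 5) * (160 * b ^ 5 / n)) ^ n := by
        rw [← mul_pow (Real.exp 1 * (2 * (b : ℝ) ^ 5))]
    _ ≤ Real.exp (n * Real.log b / 10 + 2) * (Real.exp (7 - 2 * Real.log b)) ^ n := by gcongr
    _ = Real.exp (n * Real.log b / 10 + 2 + n * (7 - 2 * Real.log b)) := by
        rw [← Real.exp_nat_mul, ← Real.exp_add]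
    _ ≤ 1 / (20 * n) := by
        refine exp_neg_le hn40 ?_
        nlinarith [mul_le_mul_of_nonneg_right hβ hn0.le]

/-- In an attack with `K` times as many lookups as there are queries, it is rare that half of the
unexcludable queries are used up. -/
theorem potential_parameter {K : ℕ} (hb : 2 ^ 20 ≤ b) (hK : 3 * K + 2 ≤ b) (hn1 : b ^ 12 ≤ n) :
    (1 + n / (n * b ^ 3 : ℕ) : ℝ) ^ (2 * n * b ^ 5 * K) * (1 / 2) ^ (n * b ^ 3)
      ≤ 1 / (20 * n) := by
  have hbn : b ≤ n := le_trans (Nat.le_self_pow (by norm_num) b) hn1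
  have hn40 : 40 ≤ n := by omega
  have hb1 : (1 : ℝ) ≤ b := by
    have : 1 ≤ b := by omega
    exact_mod_cast this
  have hb' : (0 : ℝ) < b := by linarith
  have hn' : (0 : ℝ) < n := by
    have : 0 < n := by omega
    exact_mod_cast this
  have hK' : 3 * (K : ℝ) + 2 ≤ b := by exact_mod_cast hK
  have e : (n / (n * b ^ 3 : ℕ) : ℝ) = 1 / b ^ 3 := by
    push_cast; field_simp
  have h1 : (1 + 1 / b ^ 3 : ℝ) ^ (2 * n * b ^ 5 * K) ≤ Real.exp (2 * n * b ^ 2 * K) := by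
    calc (1 + 1 / b ^ 3 : ℝ) ^ (2 * n * b ^ 5 * K)
        ≤ Real.exp (1 / b ^ 3) ^ (2 * n * b ^ 5 * K) := by
          gcongr
          rw [add_comm]; exact Real.add_one_le_exp _
      _ = _ := by
          rw [← Real.exp_nat_mul]
          congr 1
          push_cast
          field_simp
  have h2 : (1 / 2 : ℝ) ^ (n * b ^ 3) ≤ Real.exp (-(n * b ^ 3 * 0.69)) := by
    have h := Real.log_two_gt_d9
    have : (1 / 2 : ℝ) = Real.exp (-Real.log 2) := by
      rw [Real.exp_neg, Real.exp_log (by norm_num), one_div]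
    rw [this, ← Real.exp_nat_mul, Real.exp_le_exp]
    push_cast
    have : (0 : ℝ) ≤ n * b ^ 3 := by positivity
    nlinarith
  rw [e]
  calc _ ≤ Real.exp (2 * n * b ^ 2 * K) * Real.exp (-(n * b ^ 3 * 0.69)) := by gcongr
    _ = Real.exp (2 * n * b ^ 2 * K + -(n * b ^ 3 * 0.69)) := by rw [Real.exp_add]
    _ ≤ 1 / (20 * n) := by
        refine exp_neg_le hn40 ?_
        have h3 : (1 : ℝ) ≤ b ^ 2 := one_le_pow₀ hb1
        have h4 : (1 : ℝ) ≤ 0.69 * b - 2 * K := by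
          have : (0 : ℝ) ≤ K := by positivity
          linarith
        have h5 : (1 : ℝ) ≤ b ^ 2 * (0.69 * b - 2 * K) := by nlinarith
        have h6 := mul_le_mul_of_nonneg_left h5 hn'.le
        nlinarith

/-- It is rare that a query is one of the inserted elements. -/
theorem hitting_parameter (hb : 2 ^ 20 ≤ b) (hn1 : b ^ 12 ≤ n) {u : ℕ} (hu : n ^ 4 < u) :
    (n * (2 * n * b ^ 5 : ℕ) : ℝ) ≤ 1 / (20 * n) * u := by
  have hbn : b ≤ n := le_trans (Nat.le_self_pow (by norm_num) b) hn1
  have hn' : (0 : ℝ) < n := by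
    have : 0 < n := by omega
    exact_mod_cast this
  have hu' : (n : ℝ) ^ 4 ≤ u := by exact_mod_cast hu.le
  have h40 : 40 * (b : ℝ) ^ 5 ≤ n := by
    have h1 : 40 * b ^ 5 ≤ b ^ 12 := by
      calc 40 * b ^ 5 ≤ b ^ 7 * b ^ 5 := by
            gcongr
            calc 40 ≤ b := by omega
              _ ≤ b ^ 7 := Nat.le_self_pow (by norm_num) b
        _ = b ^ 12 := by ring
    exact_mod_cast h1.trans hn1
  push_cast
  calc (n : ℝ) * (2 * (n : ℝ) * (b : ℝ) ^ 5)
      = 1 / (20 * (n : ℝ)) * (40 * (b : ℝ) ^ 5 * (n : ℝ) ^ 3) := by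
        field_simp; norm_num
    _ ≤ 1 / (20 * (n : ℝ)) * ((n : ℝ) * (n : ℝ) ^ 3) := by gcongr
    _ = 1 / (20 * (n : ℝ)) * (n : ℝ) ^ 4 := by ring
    _ ≤ _ := by gcongr

theorem exists_pow_twelve_le (n b₀ : ℕ) (hn : b₀ ^ 12 ≤ n) :
    ∃ b, b₀ ≤ b ∧ b ^ 12 ≤ n ∧ n < (b + 1) ^ 12 := by
  have h1 : (Nat.findGreatest (fun b => b ^ 12 ≤ n) n) ^ 12 ≤ n :=
    Nat.findGreatest_spec (P := fun b => b ^ 12 ≤ n) (m := 0) (Nat.zero_le _) (by simp)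
  refine ⟨Nat.findGreatest (fun b => b ^ 12 ≤ n) n, ?_, h1, ?_⟩
  · exact Nat.le_findGreatest ((Nat.le_self_pow (by norm_num) b₀).trans hn) hn
  · by_contra h
    push Not at h
    have := Nat.le_findGreatest (P := fun b => b ^ 12 ≤ n)
      ((Nat.le_self_pow (by norm_num) _).trans h) h
    omega

end Parameters

/-! ### The space bound -/

section Thresholds

variable {u n b k : ℕ}

open Classical in
/-- With the parameters chosen, most pairs of insertions and queries are unexcludable. -/
theorem card_not_unexcludable_le_of_large (A : AMQ u n) (ρ : Coins) (hb : 2 ^ 20 ≤ b)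
    (hn1 : b ^ 12 ≤ n) (hn2 : n < (b + 1) ^ 12) (hu : n ^ 4 < u)
    (hk : (k : ℝ) ≤ 1 / 480 * (n * Real.logb 2 n) + 1) :
    ((Finset.univ.filter fun sQ : (Fin n → Fin u) × (Fin (2 * n * b ^ 5) → Fin u) =>
        (afterInsertions A.toAMQFunctions n ρ (List.ofFn sQ.1)).space < k ∧
        ¬ ∃ D : Finset (Fin (2 * n * b ^ 5)), 2 * (n * b ^ 3) ≤ D.card ∧
          Unexcludable A.toAMQFunctions ρ sQ.2
          (afterInsertions A.toAMQFunctions n ρ (List.ofFn sQ.1)) D n k).card : ℝ)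
      ≤ 5 * (1 / (20 * n)) * ((u : ℝ) ^ n * (u : ℝ) ^ (2 * n * b ^ 5)) := by
  have hbn : b ≤ n := le_trans (Nat.le_self_pow (by norm_num) b) hn1
  have hn' : (0 : ℝ) < n := by
    have : 0 < n := by omega
    exact_mod_cast this
  have hb1 : 1 ≤ b := by omega
  have hb' : (0 : ℝ) < b := by exact_mod_cast hb1
  have hu' : (n : ℝ) ^ 4 ≤ u := by exact_mod_cast hu.le
  have hb5 : 1 ≤ b ^ 5 := Nat.one_le_pow _ _ hb1
  refine card_not_unexcludable_le A ρ (κ := 1 / b) (ξ := 160 * b ^ 5 / n)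
    (by positivity) (by positivity) (by positivity) (by omega) ?_ (by omega) ?_ ?_
    (light_fibre_parameter hb hn1 hn2 hk) (few_popular_parameter hb hn1 hn2)
    (many_excluded_parameter hb hn1 hn2 hk) ?_ ?_
  · nlinarith
  · rw [mul_assoc]
    gcongr
    · norm_num
  · nlinarith
  · push_cast
    calc 4 * ((n : ℝ) * (2 * n * b ^ 5)) = 1 / (20 * n) * (160 * b ^ 5 / n * n ^ 4) := by
          field_simp; norm_num
      _ ≤ _ := by gcongr
  · exact hitting_parameter hb hn1 hu

theorem ceil_le_of_peak {peak : ℕ} {x y c : ℝ} (hc : 0 ≤ c) (h : ⌈c * x⌉₊ ≤ peak) :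
    c * min x y ≤ peak := by
  calc c * min x y ≤ c * x := by gcongr; exact min_le_left _ _
    _ ≤ ⌈c * x⌉₊ := Nat.le_ceil _
    _ ≤ peak := by exact_mod_cast h

theorem one_sub_le_measureReal_peakSpace (A : AMQ u n) (adv : Adversary u) {x y c p : ℝ}
    (hc : 0 ≤ c) (h : coinMeasure.real {ρ | A.peakSpace adv ρ < ⌈c * x⌉₊} ≤ p) :
    1 - p ≤ coinMeasure.real {ρ | c * min x y ≤ (A.peakSpace adv ρ : ℝ)} := by
  have h1 := probReal_compl_eq_one_sub (μ := coinMeasure)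
    (measurableSet_peakSpace_lt A adv ⌈c * x⌉₊)
  have h2 : {ρ | A.peakSpace adv ρ < ⌈c * x⌉₊}ᶜ ⊆
      {ρ | c * min x y ≤ (A.peakSpace adv ρ : ℝ)} := by
    intro ρ hρ
    simp only [Set.mem_compl_iff, Set.mem_ofPred_eq, not_lt] at hρ
    exact ceil_le_of_peak hc hρ
  have h3 := measureReal_mono (μ := coinMeasure) h2
  linarith

theorem AMQ.SustainedRateGivenHistory.rateGivenHistoryFrom {A : AMQ u n} {ε ε' : ℝ}
    (h : A.SustainedRateGivenHistory ε) (hε : ε ≤ ε') (l : List (Fin u)) :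
    RateGivenHistoryFrom A.toAMQFunctions n ε' Set.univ
      fun ρ => afterInsertions A.toAMQFunctions n ρ l := by
  intro a l'
  have := h (l.foldr Adversary.insert a) l'
  simp only [AMQ.Wins, AMQ.answers, winsFrom_foldr_insert, answersFrom_foldr_insert] at this
  simp only [Set.mem_univ, true_and]
  exact this.trans (mul_le_mul_of_nonneg_right hε measureReal_nonneg)

/-- With `K` times as many lookups as queries, the bound `(1 + ε) ^ (m * K) / 2 ^ (m * (K - 1))`
becomes exponentially small in `m`. -/
theorem exists_pow_base {ε : ℝ} (h0 : 0 ≤ ε) (h1 : ε < 1) :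
    ∃ K : ℕ, 1 ≤ K ∧ (1 + ε) ^ K ≤ Real.exp (-1) * 2 ^ (K - 1) := by
  have hlt : (1 + ε) / 2 < 1 := by linarith
  obtain ⟨K, hK⟩ := exists_pow_lt_of_lt_one (show 0 < Real.exp (-1) / 2 by positivity) hlt
  refine ⟨K + 1, by omega, ?_⟩
  rw [div_pow, div_lt_iff₀ (by positivity)] at hK
  have hp : (0 : ℝ) ≤ 2 ^ K := by positivity
  have he : 0 < Real.exp (-1) := Real.exp_pos _
  simp only [Nat.add_sub_cancel]
  rw [pow_succ]
  have : 0 ≤ (1 + ε) ^ K := by positivity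
  nlinarith

/-- Some adversary wins nearly whenever the state remains small, so this happens with probability
at most `ε + δ`. -/
theorem exists_adversary_space (ε δ : ℝ) (hδ : 0 < δ) :
    ∃ N : ℕ, ∀ n : ℕ, N ≤ n → ∀ u : ℕ, n ^ 4 < u → ∀ A : AMQ u n, A.SustainedRate ε →
      ∃ adv : Adversary u, coinMeasure.real
        {ρ | A.peakSpace adv ρ < ⌈1 / 480 * ((n : ℝ) * Real.logb 2 n)⌉₊} ≤ ε + δ := by
  obtain ⟨K, hK⟩ := exists_nat_gt (2 / δ)
  have hK0 : (0 : ℝ) < K := lt_trans (by positivity) hK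
  have hK1 : 1 ≤ K := by exact_mod_cast hK0
  refine ⟨(max (2 ^ 20) (3 * K + 2)) ^ 12, fun n hn u hu A hA => ?_⟩
  obtain ⟨b, hb, hn1, hn2⟩ := exists_pow_twelve_le n _ hn
  have hb20 : 2 ^ 20 ≤ b := (le_max_left _ _).trans hb
  have hbK : 3 * K + 2 ≤ b := (le_max_right _ _).trans hb
  have hbn : b ≤ n := le_trans (Nat.le_self_pow (by norm_num) b) hn1
  have hb5 : 1 ≤ b ^ 5 := Nat.one_le_pow _ _ (by omega)
  have hb3 : 1 ≤ b ^ 3 := Nat.one_le_pow _ _ (by omega)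
  have hnK : (K : ℝ) ≤ n := by
    have : K ≤ n := by omega
    exact_mod_cast this
  have hkle : ((⌈1 / 480 * ((n : ℝ) * Real.logb 2 n)⌉₊ : ℕ) : ℝ)
      ≤ 1 / 480 * (n * Real.logb 2 n) + 1 := by
    refine (Nat.ceil_lt_add_one ?_).le
    have : 0 ≤ Real.logb 2 n := Real.logb_nonneg (by norm_num) (by
      have : 1 ≤ n := by omega
      exact_mod_cast this)
    positivity
  obtain ⟨adv, hadv⟩ := exists_adversary_fail_le A (m := 2 * n * b ^ 5) (d := 2 * (n * b ^ 3))
    (r := n) (k := ⌈1 / 480 * ((n : ℝ) * Real.logb 2 n)⌉₊) (ℓ := n * b ^ 3) (K := K)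
    (η := 5 * (1 / (20 * n))) (Λ := 1 / (20 * n)) (by nlinarith) (by omega) (by nlinarith) le_rfl
    hK1 (potential_parameter hb20 hbK hn1)
    (fun ρ => card_not_unexcludable_le_of_large A ρ hb20 hn1 hn2 hu hkle)
  refine ⟨adv, ?_⟩
  have hsub : {ρ | A.peakSpace adv ρ < ⌈1 / 480 * ((n : ℝ) * Real.logb 2 n)⌉₊} ⊆
      {ρ | A.peakSpace adv ρ < ⌈1 / 480 * ((n : ℝ) * Real.logb 2 n)⌉₊ ∧ ¬ A.Wins adv ρ} ∪
      {ρ | A.Wins adv ρ} := by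
    intro ρ hρ
    by_cases hw : A.Wins adv ρ
    · exact Or.inr hw
    · exact Or.inl ⟨hρ, hw⟩
  have h1 := (measureReal_mono (μ := coinMeasure) hsub).trans (measureReal_union_le _ _)
  have h2 := hA adv
  have h3 : (1 : ℝ) / K ≤ δ / 2 := by
    rw [div_lt_iff₀ hδ] at hK
    rw [div_le_div_iff₀ hK0 (by norm_num)]
    linarith
  have h4 : 5 * (1 / (20 * (n : ℝ))) + 1 / (20 * n) ≤ 1 / K := by
    calc 5 * (1 / (20 * (n : ℝ))) + 1 / (20 * n) = 3 / 10 * (1 / n) := by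
          have : (n : ℝ) ≠ 0 := by linarith
          field_simp; norm_num
      _ ≤ 1 * (1 / K) := by gcongr; norm_num
      _ = _ := one_mul _
  linarith

/-- Insertions followed by lookups of other elements: if few of the answers are positive, except
with small probability, while the state remains small, then the state rarely remains small. -/
theorem measureReal_peakSpace_lt_le {A : AMQ u n} {ε ε' β : ℝ} {m k K : ℕ}
    (hA : A.SustainedRateGivenHistory ε) (hε : ε ≤ ε') (hε0 : 0 ≤ ε') (hK1 : 1 ≤ K)
    (hK : (1 + ε') ^ K ≤ Real.exp (-1) * 2 ^ (K - 1)) {s : Fin n → Fin u} {q : Fin m → Fin u}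
    {a : Adversary u} (hdis : ∀ i j, s i ≠ q j) (ha : OnlyLookups q (m * K) a)
    (hadv : coinMeasure.real {ρ | A.peakSpace ((List.ofFn s).foldr Adversary.insert a) ρ < k ∧
        (A.answers ((List.ofFn s).foldr Adversary.insert a) ρ).count true + m < m * K} ≤ β) :
    coinMeasure.real {ρ | A.peakSpace ((List.ofFn s).foldr Adversary.insert a) ρ < k}
      ≤ β + Real.exp (-m) := by
  have hcount := RateGivenHistoryFrom.measureReal_count_le (q := q) hε0 (m * K) a (m * (K - 1))
    Set.univ _ MeasurableSet.univ (measurableFibres_afterInsertions A.toAMQFunctions n (List.ofFn s))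
    (hA.rateGivenHistoryFrom hε (List.ofFn s))
    (fun ρ j => by
      rw [mem_afterInsertions_ofFn]
      rintro ⟨i, hi⟩
      exact hdis i j hi) ha
  rw [Set.univ_inter, probReal_univ, mul_one] at hcount
  have hcount' : coinMeasure.real {ρ | m * (K - 1) ≤ (A.answersFrom n ρ a
      (afterInsertions A.toAMQFunctions n ρ (List.ofFn s))).count true} ≤ Real.exp (-m) := by
    have h1 : (1 + ε') ^ (m * K) ≤ 2 ^ (m * (K - 1)) * Real.exp (-m) := by
      calc (1 + ε') ^ (m * K) = ((1 + ε') ^ K) ^ m := by rw [← pow_mul, mul_comm]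
        _ ≤ (Real.exp (-1) * 2 ^ (K - 1)) ^ m := by gcongr
        _ = _ := by
            rw [mul_pow, ← Real.exp_nat_mul, ← pow_mul, mul_comm (K - 1) m, mul_comm]
            congr 2
            ring
    exact le_of_mul_le_mul_left (hcount.trans h1) (by positivity)
  have hsub : {ρ | A.peakSpace ((List.ofFn s).foldr Adversary.insert a) ρ < k} ⊆
      {ρ | A.peakSpace ((List.ofFn s).foldr Adversary.insert a) ρ < k ∧
        (A.answers ((List.ofFn s).foldr Adversary.insert a) ρ).count true + m < m * K} ∪
      {ρ | m * (K - 1) ≤ (A.answersFrom n ρ a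
        (afterInsertions A.toAMQFunctions n ρ (List.ofFn s))).count true} := by
    intro ρ hρ
    by_cases hc : (A.answers ((List.ofFn s).foldr Adversary.insert a) ρ).count true + m < m * K
    · exact Or.inl ⟨hρ, hc⟩
    · refine Or.inr ?_
      have e : A.answers ((List.ofFn s).foldr Adversary.insert a) ρ = A.answersFrom n ρ a
          (afterInsertions A.toAMQFunctions n ρ (List.ofFn s)) :=
        answersFrom_foldr_insert A.toAMQFunctions n ρ a (List.ofFn s) _
      rw [e] at hc
      simp only [Set.mem_ofPred_eq]
      have : m * K = m * (K - 1) + m := by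
        rw [← Nat.mul_succ, Nat.succ_eq_add_one, Nat.sub_add_cancel hK1]
      omega
  exact ((measureReal_mono (μ := coinMeasure) hsub).trans (measureReal_union_le _ _)).trans
    (add_le_add hadv hcount')

/-- Some adversary receives almost only false positives if the state remains small, which is
exponentially unlikely under a rate regardless of the history.  The rate `ε` is replaced by
`max ε 0`, since a negative rate is not excluded. -/
theorem exists_adversary_space_of_history (ε : ℝ) (hε : ε < 1) :
    ∃ N : ℕ, ∀ n : ℕ, N ≤ n → ∀ u : ℕ, n ^ 4 < u → ∀ A : AMQ u n,
      A.SustainedRateGivenHistory ε → ∃ adv : Adversary u, coinMeasure.real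
        {ρ | A.peakSpace adv ρ < ⌈1 / 480 * ((n : ℝ) * Real.logb 2 n)⌉₊} ≤ 1 / n := by
  obtain ⟨K, hK1, hK⟩ := exists_pow_base (le_max_right ε 0) (max_lt hε one_pos)
  refine ⟨(max (2 ^ 20) (3 * K + 2)) ^ 12, fun n hn u hu A hA => ?_⟩
  obtain ⟨b, hb, hn1, hn2⟩ := exists_pow_twelve_le n _ hn
  clear hn
  have hb20 : 2 ^ 20 ≤ b := (le_max_left _ _).trans hb
  have hbK : 3 * K + 2 ≤ b := (le_max_right _ _).trans hb
  have hbn : b ≤ n := le_trans (Nat.le_self_pow (by norm_num) b) hn1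
  have hb5 : 1 ≤ b ^ 5 := Nat.one_le_pow _ _ (by omega)
  have hb3 : 1 ≤ b ^ 3 := Nat.one_le_pow _ _ (by omega)
  have hn1' : (1 : ℝ) ≤ n := by
    have : 1 ≤ n := by omega
    exact_mod_cast this
  have hnm : n ≤ 2 * n * b ^ 5 := by nlinarith
  have hkle : ((⌈1 / 480 * ((n : ℝ) * Real.logb 2 n)⌉₊ : ℕ) : ℝ)
      ≤ 1 / 480 * (n * Real.logb 2 n) + 1 := by
    refine (Nat.ceil_lt_add_one ?_).le
    have : 0 ≤ Real.logb 2 n := Real.logb_nonneg (by norm_num) hn1'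
    positivity
  have h20 : 1 / (20 * (n : ℝ)) ≤ 1 / 20 := by
    rw [div_le_div_iff₀ (by positivity) (by norm_num)]; linarith
  obtain ⟨s, q, a, hdis, ha, hadv⟩ := exists_adversary_few_positive_le A (m := 2 * n * b ^ 5)
    (d := 2 * (n * b ^ 3)) (r := n) (k := ⌈1 / 480 * ((n : ℝ) * Real.logb 2 n)⌉₊) (ℓ := n * b ^ 3)
    (T := 2 * n * b ^ 5 * K) (η := 5 * (1 / (20 * n))) (η' := 1 / (20 * n)) (Λ := 1 / (20 * n))
    (by omega) (by omega) (by nlinarith) le_rfl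
    (potential_parameter hb20 hbK hn1) (hitting_parameter hb20 hn1 hu) (by linarith)
    (fun ρ => card_not_unexcludable_le_of_large A ρ hb20 hn1 hn2 hu hkle)
  refine ⟨_, (measureReal_peakSpace_lt_le hA (le_max_left ε 0) (le_max_right ε 0) hK1 hK hdis ha
    hadv).trans ?_⟩
  have hexp : Real.exp (-(2 * n * b ^ 5 : ℕ)) ≤ 1 / (20 * n) := by
    refine exp_neg_le (by omega) ?_
    have : (n : ℝ) ≤ (2 * n * b ^ 5 : ℕ) := by exact_mod_cast hnm
    linarith
  have h4 : 1 / (20 * (n : ℝ)) + 5 * (1 / (20 * n)) + 1 / (20 * n) + 1 / (20 * n) ≤ 1 / n := by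
    calc _ = 2 / 5 * (1 / (n : ℝ)) := by
          have : (n : ℝ) ≠ 0 := by linarith
          field_simp; norm_num
      _ ≤ 1 * (1 / (n : ℝ)) := by gcongr; norm_num
      _ = _ := one_mul _
  linarith

end Thresholds

theorem mainTheorem1 (ε : ℝ) (hε : ε < 1) :
    ∃ c : ℝ, 0 < c ∧
      (∀ δ : ℝ, 0 < δ → ∃ N : ℕ, ∀ n : ℕ, N ≤ n → ∀ u : ℕ, n ^ 4 < u →
        ∀ A : AMQ u n, A.SustainedRate ε →
          ∃ adv : Adversary u,
            1 - ε - δ ≤ coinMeasure.real {ρ : Coins |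
              c * min ((n : ℝ) * Real.logb 2 n) ((n : ℝ) * Real.logb 2 (Real.logb 2 u))
                ≤ (A.peakSpace adv ρ : ℝ)}) ∧
      (∃ N : ℕ, ∀ n : ℕ, N ≤ n → ∀ u : ℕ, n ^ 4 < u →
        ∀ A : AMQ u n, A.SustainedRateGivenHistory ε →
          ∃ adv : Adversary u,
            1 - 1 / (n : ℝ) ≤ coinMeasure.real {ρ : Coins |
              c * min ((n : ℝ) * Real.logb 2 n) ((n : ℝ) * Real.logb 2 (Real.logb 2 u))
                ≤ (A.peakSpace adv ρ : ℝ)}) := by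
  refine ⟨1 / 480, by norm_num, fun δ hδ => ?_, ?_⟩
  · obtain ⟨N, hN⟩ := exists_adversary_space ε δ hδ
    refine ⟨N, fun n hn u hu A hA => ?_⟩
    obtain ⟨adv, hadv⟩ := hN n hn u hu A hA
    refine ⟨adv, ?_⟩
    rw [sub_sub]
    exact one_sub_le_measureReal_peakSpace A adv (by norm_num) hadv
  · obtain ⟨N, hN⟩ := exists_adversary_space_of_history ε hε
    refine ⟨N, fun n hn u hu A hA => ?_⟩
    obtain ⟨adv, hadv⟩ := hN n hn u hu A hA
    exact ⟨adv, one_sub_le_measureReal_peakSpace A adv (by norm_num) hadv⟩
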